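/- Consider the fading channel $\mathbf y=\sqrt{\mathsf{snr}}\,\mathbf H\mathbf x+\mathbf n$, where $\mathbf n\sim\mathcal{CN}(\mathbf 0,\mathbf I)$ in $\mathbb C^{n_r}$, $\mathbf H$ is a random matrix in $\mathbb C^{n_r\times n_t}$, $\mathbf x$ is uniformly distributed on a constellation of $M$ distinct points $\mathbf x_1,\dots,\mathbf x_M\in\mathbb C^{n_t}$, and $\mathbf H,\mathbf x,\mathbf n$ are independent. For a fixed matrix $\mathbf A$ put $$\mathsf{mmse}(\mathsf{snr};\mathbf A)=\mathbb E\big\{\|\mathbf A\mathbf x-\mathbf A\,\mathbb E\{\mathbf x\mid\sqrt{\mathsf{snr}}\,\mathbf A\mathbf x+\mathbf n\}\|^2\big\},\qquad \overline{\mathsf{mmse}}(\mathsf{snr})=\mathbb E_{\mathbf H}\{\mathsf{mmse}(\mathsf{snr};\mathbf H)\}.$$ Suppose that for all $i\ne j$ the squared distance $\|\mathbf H\mathbf x_i-\mathbf H\mathbf x_j\|^2$ has a probability density function $p_{ij}$ on $[0,\infty)$ whose derivatives $p_{ij}^{(n)}$, $n=0,1,2,\dots$, all exist (one-sidedly at $0$)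 and are continuous and integrable on $[0,\infty)$. Let $S_n=\sum_{i=1}^{M}\sum_{j\neq i}p_{ij}^{(n)}(0)$, suppose that $S_n\neq0$ for some $n$, and let $d=1+\min\{n\ge 0: S_n\neq 0\}$. Put $$k_{\mathrm{LB}_n}=\frac{1}{2M(M-1)}\cdot\frac{n\,4^n}{\sqrt\pi}\cdot\frac{\Gamma(n+3/2)}{\Gamma(n+2)},\qquad k_{\mathrm{UB}_n}=\frac{2}{M}\cdot\frac{n\,4^n}{\sqrt\pi}\cdot\frac{\Gamma(n+3/2)}{\Gamma(n+2)}.$$ Then $\overline{\mathsf{mmse}}(\mathsf{snr})$ is finite for every $\mathsf{snr}>0$, and there is a piecewise infinitely differentiable function $\epsilon_d$ on $(0,\infty)$ such that, as $\mathsf{snr}\to\infty$, $$\overline{\mathsf{mmse}}(\mathsf{snr})=\epsilon_d(\mathsf{snr})\cdot\frac1{\mathsf{snr}^{d+1}}+O\Big(\frac1{\mathsf{snr}^{d+2}}\Big),$$ such that, for some $\mathsf{snr}_0>0$ and all $\mathsf{snr}\ge\mathsf{snr}_0$, $$k_{\mathrm{LB}_d}\,S_{d-1}\le\epsilon_d(\mathsf{snr})\le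 k_{\mathrm{UB}_d}\,S_{d-1},$$ and such that $$\limsup_{\mathsf{snr}\to\infty}\epsilon_d(\mathsf{snr})=\limsup_{\mathsf{snr}\to\infty}\mathsf{snr}^{d+1}\,\overline{\mathsf{mmse}}(\mathsf{snr}),\qquad \liminf_{\mathsf{snr}\to\infty}\epsilon_d(\mathsf{snr})=\liminf_{\mathsf{snr}\to\infty}\mathsf{snr}^{d+1}\,\overline{\mathsf{mmse}}(\mathsf{snr}).$$ -/

import Mathlib

open MeasureTheory ProbabilityTheory Filter Set Asymptotics
open scoped ENNReal NNReal

noncomputable section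

namespace FadingMMSE

/-- Complex column vectors with the Euclidean norm. -/
abbrev CVec (n : ℕ) : Type := EuclideanSpace ℂ (Fin n)

/-- Complex `r × t` channel matrices. -/
abbrev CMat (r t : ℕ) : Type := Matrix (Fin r) (Fin t) ℂ

/-- The product σ-algebra on matrices (measurability of every entry). -/
instance instMeasurableSpaceCMat (r t : ℕ) : MeasurableSpace (CMat r t) :=
  inferInstanceAs (MeasurableSpace (Fin r → Fin t → ℂ))

/-- Matrix-vector product `A x`. -/
def apply {r t : ℕ} (A : CMat r t) (x : CVec t) : CVec r :=
  WithLp.toLp 2 (A.mulVec x.ofLp)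

/-- The law `CN(0, 1)` on `ℂ`: independent real and imaginary parts, each `N(0, 1/2)`. -/
def stdCN : Measure ℂ :=
  ((gaussianReal 0 (1 / 2)).prod (gaussianReal 0 (1 / 2))).map
    (fun z : ℝ × ℝ => (z.1 : ℂ) + (z.2 : ℂ) * Complex.I)

/-- The law `CN(0, I)` on `ℂⁿ`: independent `CN(0, 1)` coordinates. -/
def stdCNVec (n : ℕ) : Measure (CVec n) :=
  (Measure.pi (fun _ : Fin n => stdCN)).map (WithLp.toLp 2)

/-- Squared distance between the noiseless received vectors `A u` and `A v`. -/
def sqDist {r t : ℕ} (A : CMat r t) (u v : CVec t) : ℝ :=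
  ‖apply A u - apply A v‖ ^ 2

/-- `q` is, on `[0, ∞)`, the probability density function of the nonnegative random
variable `D`. -/
def IsPdfOnNonneg {Ω : Type*} [MeasurableSpace Ω] (P : Measure Ω) (D : Ω → ℝ) (q : ℝ → ℝ) :
    Prop :=
  (∀ t ∈ Ici (0 : ℝ), 0 ≤ q t) ∧
    P.map D = (volume.restrict (Ici (0 : ℝ))).withDensity (fun t => ENNReal.ofReal (q t))

/-- The `n`-th derivative on `[0, ∞)`; at `0` it is the one-sided derivative. -/
def derivNonneg (n : ℕ) (q : ℝ → ℝ) (t : ℝ) : ℝ :=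
  iteratedDerivWithin n q (Ici 0) t

/-- All derivatives of `q` (of order `0, 1, 2, …`) exist and are continuous and integrable
on `[0, ∞)`. -/
def HasContinuousIntegrableDerivs (q : ℝ → ℝ) : Prop :=
  ContDiffOn ℝ (⊤ : ℕ∞) q (Ici 0) ∧ ∀ n : ℕ, IntegrableOn (derivNonneg n q) (Ici 0) volume

/-- The channel output `√snr · A x + n` for a fixed channel matrix `A`. -/
def output {Ω : Type*} {r t : ℕ} (x : Ω → CVec t) (noise : Ω → CVec r) (snr : ℝ)
    (A : CMat r t) (ω : Ω) : CVec r :=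
  (Real.sqrt snr : ℂ) • apply A (x ω) + noise ω

/-- `mmse(snr; A) = E‖A x - A E{x | √snr · A x + n}‖²` for a fixed channel matrix `A`. -/
def mmse {Ω : Type*} [MeasurableSpace Ω] (P : Measure Ω) {r t : ℕ} (x : Ω → CVec t)
    (noise : Ω → CVec r) (snr : ℝ) (A : CMat r t) : ℝ :=
  ∫ ω, ‖apply A (x ω) - apply A
    ((P[x | MeasurableSpace.comap (output x noise snr A) inferInstance]) ω)‖ ^ 2 ∂P

/-- The average of `mmse(snr; H)` over the random channel matrix `H`. -/
def avgMmse {Ω : Type*} [MeasurableSpace Ω] (P : Measure Ω) {r t : ℕ} (H : Ω → CMat r t)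
    (x : Ω → CVec t) (noise : Ω → CVec r) (snr : ℝ) : ℝ :=
  ∫ ω, mmse P x noise snr (H ω) ∂P

/-- `∑_{i ≠ j} p_{ij}⁽ⁿ⁾(0)`. -/
def pairSum {M : ℕ} (p : Fin M → Fin M → ℝ → ℝ) (n : ℕ) : ℝ :=
  ∑ i, ∑ j ∈ Finset.univ.erase i, derivNonneg n (p i j) 0

/-- `d = 1 + min {n : ∑_{i ≠ j} p_{ij}⁽ⁿ⁾(0) ≠ 0}`. -/
def order {M : ℕ} (p : Fin M → Fin M → ℝ → ℝ) : ℕ :=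
  1 + sInf {n : ℕ | pairSum p n ≠ 0}

/-- The constant `k_{LB_n}`. -/
def kLB (M n : ℕ) : ℝ :=
  1 / (2 * (M : ℝ) * ((M : ℝ) - 1)) * ((n : ℝ) * 4 ^ n / Real.sqrt Real.pi) *
    (Real.Gamma ((n : ℝ) + 3 / 2) / Real.Gamma ((n : ℝ) + 2))

/-- The constant `k_{UB_n}`. -/
def kUB (M n : ℕ) : ℝ :=
  2 / (M : ℝ) * ((n : ℝ) * 4 ^ n / Real.sqrt Real.pi) *
    (Real.Gamma ((n : ℝ) + 3 / 2) / Real.Gamma ((n : ℝ) + 2))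

/-- `f` is piecewise infinitely differentiable on `s`: outside a set `B` of breakpoints that
meets every compact interval with end points in `s` in a finite set, and on every closed
interval without interior breakpoints `f` is infinitely differentiable (one-sidedly at the
end points). -/
def PiecewiseSmoothOn (f : ℝ → ℝ) (s : Set ℝ) : Prop :=
  ∃ B : Set ℝ, (∀ a ∈ s, ∀ b ∈ s, (B ∩ Icc a b).Finite) ∧
    ∀ a b : ℝ, a < b → Icc a b ⊆ s → Disjoint (Ioo a b) B → ContDiffOn ℝ (⊤ : ℕ∞) f (Icc a b)

end FadingMMSE

end

/-!
For a fixed channel matrix `A` put `zᵢ = A cᵢ`, `δᵢⱼ = ‖zᵢ - zⱼ‖`, and let `φᵢ(y)` be the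
likelihood of `cᵢ` given the output `y`. By Bayes' rule (`UniformGaussian.condExp_ae_eq`) the
conditional mean of `A x` is the mean of the `zᵢ` with weights `φᵢ(y)`, so that `M · mmse` is the
integral over `y` of `∑ᵢ φᵢ ‖zᵢ - mean‖²`. This integrand is compared, for every `y`, with
`B = ∑_{i ≠ j} δᵢⱼ² φᵢ 1[φᵢ ≤ φⱼ]`: the mean is at least as good as the most likely point, which gives
the upper bound `B`; and no estimate is close to both `zᵢ` and `zⱼ`, which gives the lower bound
`B / (4 (M - 1))`. The integral of `φᵢ 1[φᵢ ≤ φⱼ]` is the Gaussian measure of a half-space, hence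
a tail `Q(snr δᵢⱼ²)` of a real Gaussian of variance `1/2`. Thus `mmse` lies between
`T / (4 M (M - 1))` and `T / M`, where `T = ∑_{i ≠ j} δᵢⱼ² Q(snr δᵢⱼ²)` (`UniformGaussian.pairTail_le_mmse`,
`UniformGaussian.mmse_le`).

Averaging over the channel turns the terms of `T` into `∫₀^∞ pᵢⱼ(t) t Q(snr t) dt`. Expanding
`pᵢⱼ` at `0` (`exists_integral_mul_gaussTail_bound`) and inserting the moments of `Q`, which
follow from the layer cake formula, gives an expansion in powers of `1 / snr`. Summed over the
pairs, its coefficients are multiples of `S₀, S₁, …`, so the first term that survives is the one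
with `S_{d-1}`, of order `snr^{-(d+1)}`, and its constant yields `k_LB` and `k_UB` exactly
(`exists_integral_pairTail_bound`).

Hence `f(snr) = snr^{d+1} · avgMmse(snr)` lies between `k_LB S_{d-1}` and `k_UB S_{d-1}` up to
`O(1 / snr)`. Since `f` is continuous (dominated convergence), a partition of unity provides a
smooth `ε` with values between the two constants and within `O(1 / snr)` of `f`
(`exists_smooth_coefficient`). Then `f - ε` tends to `0`, so the upper and lower limits agree.
-/

namespace FadingMMSE

open scoped Topology RealInnerProductSpace

/-! ### The law `CN(0, I)` -/

instance : IsProbabilityMeasure stdCN :=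
  Measure.isProbabilityMeasure_map (by fun_prop)

instance (n : ℕ) : IsProbabilityMeasure (stdCNVec n) :=
  Measure.isProbabilityMeasure_map (by fun_prop)

lemma charFun_stdCN (w : ℂ) :
    charFun stdCN w = Complex.exp (-((‖w‖ ^ 2 : ℝ) : ℂ) / 4) := by
  have h1 : ∀ z : ℝ × ℝ,
      Complex.exp (((⟪(z.1 : ℂ) + (z.2 : ℂ) * Complex.I, w⟫ : ℝ) : ℂ) * Complex.I)
      = Complex.exp (w.re * z.1 * Complex.I) * Complex.exp (w.im * z.2 * Complex.I) := by
    intro z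
    rw [← Complex.exp_add]
    congr 1
    simp [Complex.inner]
    ring
  have h2 : ‖w‖ ^ 2 = w.re ^ 2 + w.im ^ 2 := by
    rw [Complex.sq_norm, Complex.normSq_apply]; ring
  rw [charFun_apply, stdCN, integral_map (by fun_prop) (by fun_prop)]
  simp_rw [h1]
  rw [integral_prod_mul (f := fun a : ℝ => Complex.exp (w.re * a * Complex.I))
    (g := fun a : ℝ => Complex.exp (w.im * a * Complex.I)), ← charFun_apply_real,
    ← charFun_apply_real, charFun_gaussianReal, charFun_gaussianReal, ← Complex.exp_add, h2]
  congr 1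
  push_cast
  ring

lemma charFun_stdCNVec (n : ℕ) (t : CVec n) :
    charFun (stdCNVec n) t = Complex.exp (-((‖t‖ ^ 2 : ℝ) : ℂ) / 4) := by
  rw [stdCNVec, charFun_pi]
  simp_rw [charFun_stdCN]
  rw [← Complex.exp_sum, EuclideanSpace.norm_sq_eq]
  congr 1
  push_cast
  rw [← Finset.sum_div, Finset.sum_neg_distrib]

/-- The density `π⁻ⁿ exp (-‖y‖²)` of `CN(0, I)` with respect to Lebesgue measure on `ℂⁿ`. -/
noncomputable def gaussDensity (n : ℕ) (y : CVec n) : ℝ :=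
  (Real.pi ^ n)⁻¹ * Real.exp (-‖y‖ ^ 2)

lemma gaussDensity_pos (n : ℕ) (y : CVec n) : 0 < gaussDensity n y := by
  unfold gaussDensity; positivity

@[fun_prop]
lemma continuous_gaussDensity (n : ℕ) : Continuous (gaussDensity n) := by
  unfold gaussDensity; fun_prop

lemma gaussDensity_le_iff {n : ℕ} (y z : CVec n) :
    gaussDensity n y ≤ gaussDensity n z ↔ ‖z‖ ≤ ‖y‖ := by
  unfold gaussDensity
  rw [mul_le_mul_iff_of_pos_left (by positivity), Real.exp_le_exp, neg_le_neg_iff,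
    sq_le_sq₀ (norm_nonneg _) (norm_nonneg _)]

lemma finrank_real_cvec (n : ℕ) : Module.finrank ℝ (CVec n) = 2 * n := by
  rw [← Module.finrank_mul_finrank ℝ ℂ (CVec n)]
  simp

lemma integral_gaussDensity_mul_cexp (n : ℕ) (t : CVec n) :
    ∫ y, (gaussDensity n y : ℂ) * Complex.exp ((⟪y, t⟫ : ℝ) * Complex.I) =
      Complex.exp (-((‖t‖ ^ 2 : ℝ) : ℂ) / 4) := by
  have h := GaussianFourier.integral_cexp_neg_mul_sq_norm_add (V := CVec n) (b := 1) (by simp)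
    Complex.I t
  have h2 : ∀ y : CVec n, (gaussDensity n y : ℂ) * Complex.exp ((⟪y, t⟫ : ℝ) * Complex.I) =
      ((Real.pi : ℂ) ^ n)⁻¹ * Complex.exp (-1 * (‖y‖ : ℂ) ^ 2 + Complex.I * (⟪t, y⟫ : ℝ)) := by
    intro y
    rw [gaussDensity, real_inner_comm, Complex.exp_add]
    push_cast
    rw [mul_assoc]
    congr 3
    · ring
    · ring
  simp_rw [h2]
  rw [integral_const_mul, h, finrank_real_cvec]
  have : (((2 * n : ℕ) : ℂ) / 2) = (n : ℂ) := by push_cast; ring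
  rw [this, Complex.cpow_natCast, div_one, ← mul_assoc, inv_mul_cancel₀, one_mul]
  · congr 1
    rw [Complex.I_sq]
    push_cast
    ring
  · exact pow_ne_zero _ (by exact_mod_cast Real.pi_ne_zero)

lemma integrable_gaussDensity (n : ℕ) : Integrable (gaussDensity n) := by
  have h := GaussianFourier.integrable_cexp_neg_mul_sq_norm_add (V := CVec n) (b := 1) (by simp)
    0 0
  have h2 := (h.norm).const_mul ((Real.pi ^ n)⁻¹)
  refine h2.congr (ae_of_all _ fun y => ?_)
  simp only [gaussDensity, Complex.norm_exp]
  congr 2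
  simp [← Complex.ofReal_pow]

/-- `CN(0, I)` has density `gaussDensity`: both measures have the same characteristic function. -/
lemma stdCNVec_eq_withDensity (n : ℕ) :
    stdCNVec n = volume.withDensity (fun y => ENNReal.ofReal (gaussDensity n y)) := by
  have : IsFiniteMeasure
      ((volume : Measure (CVec n)).withDensity (fun y => ENNReal.ofReal (gaussDensity n y))) :=
    isFiniteMeasure_withDensity_ofReal (integrable_gaussDensity n).2
  refine Measure.ext_of_charFun (funext fun t => ?_)
  rw [charFun_stdCNVec, charFun_apply, integral_withDensity_eq_integral_toReal_smul
    (by fun_prop) (by simp), ← integral_gaussDensity_mul_cexp]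
  refine integral_congr_ae (ae_of_all _ fun y => ?_)
  simp [ENNReal.toReal_ofReal (gaussDensity_pos n y).le]

section Translate

variable {E : Type*} [NormedAddCommGroup E] [NormedSpace ℝ E]

lemma integral_add_stdCNVec {n : ℕ} (a : CVec n) (F : CVec n → E) :
    ∫ v, F (a + v) ∂(stdCNVec n) = ∫ y, gaussDensity n (y - a) • F y := by
  rw [stdCNVec_eq_withDensity, integral_withDensity_eq_integral_toReal_smul
    (by fun_prop) (by simp),
    ← integral_add_left_eq_self (fun y => gaussDensity n (y - a) • F y) a]
  refine integral_congr_ae (ae_of_all _ fun y => ?_)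
  simp [ENNReal.toReal_ofReal (gaussDensity_pos n y).le]

lemma integrable_gaussDensity_smul {n : ℕ} (a : CVec n) {F : CVec n → E}
    (hF : Integrable (fun v => F (a + v)) (stdCNVec n)) :
    Integrable (fun y => gaussDensity n (y - a) • F y) := by
  rw [stdCNVec_eq_withDensity, integrable_withDensity_iff_integrable_smul' (by fun_prop)
    (by simp)] at hF
  refine (hF.comp_sub_right a).congr (ae_of_all _ fun y => ?_)
  simp [ENNReal.toReal_ofReal (gaussDensity_pos n (y - a)).le]

end Translate

/-! ### Half-spaces and the Gaussian tail -/

/-- The tail `P(W ≥ √u / 2)` of a real Gaussian `W` of variance `1/2`; this is the error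
probability `Q(√(u/2))` between two points at squared distance `u`. -/
noncomputable def gaussTail (u : ℝ) : ℝ := (gaussianReal 0 (1 / 2)).real (Ici (Real.sqrt u / 2))

lemma map_inner_stdCNVec {n : ℕ} (v : CVec n) (hv : ‖v‖ = 1) :
    (stdCNVec n).map (fun y => ⟪v, y⟫) = gaussianReal 0 (1 / 2) := by
  have : IsProbabilityMeasure ((stdCNVec n).map (fun y => ⟪v, y⟫)) :=
    Measure.isProbabilityMeasure_map (by fun_prop)
  refine Measure.ext_of_charFun (funext fun s => ?_)
  have h1 : charFun ((stdCNVec n).map (fun y => ⟪v, y⟫)) s = charFun (stdCNVec n) (s • v) := by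
    rw [charFun_apply, charFun_apply, integral_map (by fun_prop) (by fun_prop)]
    refine integral_congr_ae (ae_of_all _ fun y => ?_)
    simp [inner_smul_right, real_inner_comm]
  rw [h1, charFun_stdCNVec, charFun_gaussianReal, norm_smul, hv]
  congr 1
  simp
  push_cast [← Complex.ofReal_pow]
  ring

/-- Under Gaussian noise, the output for the input `a` is at least as close to `b` as to `a` with
probability `gaussTail (‖a - b‖²)`. -/
lemma stdCNVec_real_halfSpace {n : ℕ} {a b : CVec n} (hab : a ≠ b) :
    (stdCNVec n).real {y | ‖a + y - b‖ ≤ ‖y‖} = gaussTail (‖a - b‖ ^ 2) := by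
  have hpos : 0 < ‖b - a‖ := norm_pos_iff.2 (sub_ne_zero.2 hab.symm)
  set v : CVec n := ‖b - a‖⁻¹ • (b - a) with hv
  have hv1 : ‖v‖ = 1 := by
    rw [hv, norm_smul, norm_inv, norm_norm, inv_mul_cancel₀ hpos.ne']
  have hset : {y : CVec n | ‖a + y - b‖ ≤ ‖y‖} =
      (fun y => ⟪v, y⟫) ⁻¹' (Ici (Real.sqrt (‖a - b‖ ^ 2) / 2)) := by
    ext y
    have h1 : a + y - b = y - (b - a) := by abel
    rw [mem_ofPred_eq, mem_preimage, mem_Ici, Real.sqrt_sq (norm_nonneg _), norm_sub_rev a b,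
      ← sq_le_sq₀ (norm_nonneg _) (norm_nonneg _), h1, norm_sub_sq_real, hv, inner_smul_left,
      real_inner_comm y]
    simp only [conj_trivial]
    rw [inv_mul_eq_div, div_le_div_iff₀ (by norm_num) hpos]
    constructor <;> intro h <;> nlinarith
  rw [gaussTail, ← map_inner_stdCNVec v hv1, map_measureReal_apply (by fun_prop) measurableSet_Ici,
    hset]

/-! ### Moments of the tail and Watson-type asymptotics -/

lemma gaussTail_nonneg (u : ℝ) : 0 ≤ gaussTail u := measureReal_nonneg

lemma gaussTail_antitone : Antitone gaussTail := fun u v huv =>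
  measureReal_mono (Ici_subset_Ici.2 (by gcongr))

@[fun_prop]
lemma measurable_gaussTail : Measurable gaussTail := gaussTail_antitone.measurable

/-- The moment `∫₀^∞ tᵐ gaussTail t dt`. -/
noncomputable def tailMoment (m : ℕ) : ℝ :=
  2 * 4 ^ m * Real.Gamma ((m : ℝ) + 3 / 2) / (Real.sqrt Real.pi * ((m : ℝ) + 1))

lemma tailMoment_nonneg (m : ℕ) : 0 ≤ tailMoment m := by
  have := Real.Gamma_pos_of_pos (show (0 : ℝ) < (m : ℝ) + 3 / 2 by positivity)
  unfold tailMoment; positivity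

lemma integral_pow_mul_gaussian_Ioi (m : ℕ) :
    IntegrableOn (fun w : ℝ => w ^ (2 * m + 2) * Real.exp (-w ^ 2)) (Ioi 0) ∧
    ∫ w in Ioi (0 : ℝ), w ^ (2 * m + 2) * Real.exp (-w ^ 2) = Real.Gamma ((m : ℝ) + 3 / 2) / 2 := by
  have hq : (-1 : ℝ) < 2 * m + 2 := by have := Nat.cast_nonneg (α := ℝ) m; linarith
  have h1 := integral_rpow_mul_exp_neg_rpow (p := 2) (q := 2 * m + 2) (by norm_num) hq
  have h2 := integrableOn_rpow_mul_exp_neg_rpow (p := 2) (s := 2 * m + 2) hq (by norm_num)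
  have hfun : EqOn (fun w : ℝ => w ^ (2 * (m : ℝ) + 2) * Real.exp (-w ^ (2 : ℝ)))
      (fun w : ℝ => w ^ (2 * m + 2) * Real.exp (-w ^ 2)) (Ioi 0) := by
    intro w _
    have h3 : (2 * (m : ℝ) + 2) = ((2 * m + 2 : ℕ) : ℝ) := by push_cast; ring
    simp only
    rw [h3, Real.rpow_natCast, Real.rpow_two]
  refine ⟨h2.congr_fun hfun measurableSet_Ioi, ?_⟩
  rw [← setIntegral_congr_fun measurableSet_Ioi hfun, h1]
  have h4 : (2 * (m : ℝ) + 2 + 1) / 2 = m + 3 / 2 := by ring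
  rw [h4]; ring

/-- The layer cake formula for `4 max(W, 0)²`, where `W` is Gaussian of variance `1/2`. -/
lemma lintegral_pow_mul_gaussTail (m : ℕ) :
    ∫⁻ t in Ioi (0 : ℝ), ENNReal.ofReal (t ^ m * gaussTail t) = ENNReal.ofReal (tailMoment m) := by
  set μ := gaussianReal 0 (1 / 2) with hμ
  have hm : (0 : ℝ) < (m : ℝ) + 1 := by positivity
  have hcake := lintegral_rpow_eq_lintegral_meas_le_mul μ (f := fun w => 4 * (max w 0) ^ 2)
    (ae_of_all _ fun w => by positivity) (by fun_prop) hm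
  have hR : ∫⁻ t in Ioi (0 : ℝ),
      μ {w | t ≤ 4 * (max w 0) ^ 2} * ENNReal.ofReal (t ^ ((m : ℝ) + 1 - 1))
      = ∫⁻ t in Ioi (0 : ℝ), ENNReal.ofReal (t ^ m * gaussTail t) := by
    refine setLIntegral_congr_fun measurableSet_Ioi fun t ht => ?_
    have ht0 : (0 : ℝ) < t := ht
    have hset : {w : ℝ | t ≤ 4 * (max w 0) ^ 2} = Ici (Real.sqrt t / 2) := by
      ext w
      rw [mem_ofPred_eq, mem_Ici, div_le_iff₀ (by norm_num : (0 : ℝ) < 2)]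
      have hs := Real.sqrt_pos.2 ht0
      rcases le_total w 0 with hw | hw
      · rw [max_eq_right hw]
        constructor <;> intro h <;> nlinarith
      · rw [max_eq_left hw, Real.sqrt_le_left (by positivity)]
        constructor <;> intro h <;> nlinarith
    rw [hset, add_sub_cancel_right, Real.rpow_natCast, gaussTail, mul_comm,
      ENNReal.ofReal_mul (by positivity), ofReal_measureReal]
  have hL : ∫⁻ w, ENNReal.ofReal ((4 * (max w 0) ^ 2) ^ ((m : ℝ) + 1)) ∂μ =
      ENNReal.ofReal (((m : ℝ) + 1) * tailMoment m) := by
    have hpdf : ∀ w : ℝ, gaussianPDFReal 0 (1 / 2) w =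
        (Real.sqrt Real.pi)⁻¹ * Real.exp (-w ^ 2) := by
      intro w
      rw [gaussianPDFReal]
      congr 2
      · congr 1
        push_cast
        ring
      · push_cast
        ring
    obtain ⟨hint, hval⟩ := integral_pow_mul_gaussian_Ioi m
    have hfun : ∀ w : ℝ, gaussianPDF 0 (1 / 2) w *
        ENNReal.ofReal ((4 * (max w 0) ^ 2) ^ ((m : ℝ) + 1)) = (Ioi (0 : ℝ)).indicator
        (fun w => ENNReal.ofReal (4 ^ (m + 1) * (Real.sqrt Real.pi)⁻¹ *
          (w ^ (2 * m + 2) * Real.exp (-w ^ 2)))) w := by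
      intro w
      have hc : (m : ℝ) + 1 = ((m + 1 : ℕ) : ℝ) := by push_cast; ring
      rw [hc, Real.rpow_natCast, gaussianPDF, ← ENNReal.ofReal_mul (gaussianPDFReal_nonneg _ _ _),
        hpdf]
      rcases lt_or_ge 0 w with hw | hw
      · rw [indicator_of_mem (mem_Ioi.2 hw), max_eq_left hw.le]
        congr 1
        rw [mul_pow, ← pow_mul]
        ring
      · rw [indicator_of_notMem (by simpa using hw), max_eq_right hw]
        simp
    rw [hμ, gaussianReal_of_var_ne_zero _ (by norm_num),
      lintegral_withDensity_eq_lintegral_mul _ (by fun_prop) (by fun_prop)]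
    simp only [Pi.mul_apply, hfun]
    rw [lintegral_indicator measurableSet_Ioi, ← ofReal_integral_eq_lintegral_ofReal
      (hint.const_mul _) ((ae_restrict_mem measurableSet_Ioi).mono fun w hw => ?_),
      integral_const_mul, hval, tailMoment]
    · congr 1
      field_simp
      ring
    · have : (0 : ℝ) < w := hw
      positivity
  rw [hR, hL, ENNReal.ofReal_mul hm.le] at hcake
  exact ((ENNReal.mul_right_inj (by simpa using hm) ENNReal.ofReal_ne_top).1 hcake).symm

lemma integrableOn_pow_mul_gaussTail (m : ℕ) {s : ℝ} (hs : 0 < s) :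
    IntegrableOn (fun t => t ^ m * gaussTail (s * t)) (Ioi 0) := by
  have h1 : IntegrableOn (fun t => t ^ m * gaussTail t) (Ioi 0) := by
    refine ⟨by fun_prop, ?_⟩
    rw [hasFiniteIntegral_iff_ofReal ((ae_restrict_mem measurableSet_Ioi).mono fun t ht =>
      mul_nonneg (pow_nonneg (le_of_lt ht) _) (gaussTail_nonneg t)), lintegral_pow_mul_gaussTail]
    exact ENNReal.ofReal_lt_top
  have h2 := (integrableOn_Ioi_comp_mul_left_iff (fun t => t ^ m * gaussTail t) 0 hs).2
    (by simpa using h1)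
  refine (h2.const_mul ((s ^ m)⁻¹)).congr (ae_of_all _ fun t => ?_)
  simp only [mul_pow]
  field_simp

lemma integral_pow_mul_gaussTail (m : ℕ) {s : ℝ} (hs : 0 < s) :
    ∫ t in Ioi (0 : ℝ), t ^ m * gaussTail (s * t) = tailMoment m / s ^ (m + 1) := by
  have h1 : ∫ t in Ioi (0 : ℝ), t ^ m * gaussTail t = tailMoment m := by
    rw [integral_eq_lintegral_of_nonneg_ae ((ae_restrict_mem measurableSet_Ioi).mono fun t ht =>
      mul_nonneg (pow_nonneg (le_of_lt ht) _) (gaussTail_nonneg t)) (by fun_prop),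
      lintegral_pow_mul_gaussTail, ENNReal.toReal_ofReal (tailMoment_nonneg m)]
  have h2 := integral_comp_mul_left_Ioi (fun t => t ^ m * gaussTail t) 0 hs
  rw [mul_zero, h1] at h2
  have h3 : ∀ t, t ^ m * gaussTail (s * t) = (s ^ m)⁻¹ * ((s * t) ^ m * gaussTail (s * t)) := by
    intro t
    rw [mul_pow]
    field_simp
  simp_rw [h3]
  rw [integral_const_mul, h2, smul_eq_mul, pow_succ]
  field_simp

lemma pow_mul_gaussTail_le (m : ℕ) {u : ℝ} (hu : 0 ≤ u) :
    u ^ (m + 1) * gaussTail u ≤ (m + 1) * tailMoment m := by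
  have hint := integrableOn_pow_mul_gaussTail m one_pos
  simp only [one_mul] at hint
  have hval := integral_pow_mul_gaussTail m one_pos
  simp only [one_mul, one_pow, div_one] at hval
  have h1 : ∫ t in Ioc 0 u, t ^ m * gaussTail u ≤ ∫ t in Ioc 0 u, t ^ m * gaussTail t := by
    refine setIntegral_mono_on ?_ (hint.mono_set Ioc_subset_Ioi_self) measurableSet_Ioc
      fun t ht => ?_
    · exact (Continuous.integrableOn_Icc (by fun_prop)).mono_set Ioc_subset_Icc_self
    · have := ht.1
      have := gaussTail_antitone ht.2
      gcongr
  have h2 : ∫ t in Ioc 0 u, t ^ m * gaussTail t ≤ ∫ t in Ioi 0, t ^ m * gaussTail t :=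
    setIntegral_mono_set hint ((ae_restrict_mem measurableSet_Ioi).mono fun t ht =>
      mul_nonneg (pow_nonneg (le_of_lt ht) _) (gaussTail_nonneg t))
      Ioc_subset_Ioi_self.eventuallyLE
  have h3 : ∫ t in Ioc 0 u, t ^ m * gaussTail u = u ^ (m + 1) / (m + 1) * gaussTail u := by
    rw [integral_mul_const, ← intervalIntegral.integral_of_le hu, integral_pow]
    simp
  rw [h3] at h1
  rw [hval] at h2
  have h4 := h1.trans h2
  rw [div_mul_eq_mul_div, div_le_iff₀ (by positivity)] at h4
  linarith

/-- The weight `t · gaussTail (s t)`, which appears in the averaged error bounds, is `O(1 / s)`. -/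
lemma mul_gaussTail_le {s t : ℝ} (hs : 0 < s) (ht : 0 ≤ t) :
    t * gaussTail (s * t) ≤ tailMoment 0 / s := by
  have h := pow_mul_gaussTail_le 0 (mul_nonneg hs.le ht)
  rw [le_div_iff₀ hs]
  simp at h
  nlinarith

lemma integrableOn_mul_gaussTail {q : ℝ → ℝ} (hq : IntegrableOn q (Ici 0)) {s : ℝ} (hs : 0 < s) :
    IntegrableOn (fun t => q t * (t * gaussTail (s * t))) (Ioi 0) := by
  refine (hq.mono_set Ioi_subset_Ici_self).mul_bdd (c := tailMoment 0 / s) (by fun_prop)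
    ((ae_restrict_mem measurableSet_Ioi).mono fun t ht => ?_)
  have ht0 : (0 : ℝ) ≤ t := le_of_lt ht
  rw [Real.norm_of_nonneg (mul_nonneg ht0 (gaussTail_nonneg _))]
  exact mul_gaussTail_le hs ht0

lemma exists_taylor_bound_Ioc {q : ℝ → ℝ} (hq : ContDiffOn ℝ (⊤ : ℕ∞) q (Ici 0)) (N : ℕ) :
    ∃ C, ∀ t ∈ Ioc (0 : ℝ) 1,
      |q t - ∑ n ∈ Finset.range (N + 1), derivNonneg n q 0 / n.factorial * t ^ n|
        ≤ C * t ^ (N + 1) := by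
  obtain ⟨C, hC⟩ := exists_taylor_mean_remainder_bound (n := N) (zero_le_one (α := ℝ))
    ((hq.of_le (by exact_mod_cast le_top)).mono Icc_subset_Ici_self)
  refine ⟨C, fun t ht => ?_⟩
  have h := hC t (Ioc_subset_Icc_self ht)
  rw [Real.norm_eq_abs, sub_zero, taylor_within_apply] at h
  convert! h using 4 with n
  have hd : derivNonneg n q 0 = iteratedDerivWithin n q (Icc 0 1) 0 := by
    rw [derivNonneg, iteratedDerivWithin, iteratedDerivWithin, iteratedFDerivWithin_congr_set]
    filter_upwards [Iio_mem_nhds (zero_lt_one (α := ℝ))] with x hx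
    have hx1 : x < 1 := hx
    exact propext ⟨fun h => ⟨h, hx1.le⟩, fun h => h.1⟩
  rw [hd, smul_eq_mul, sub_zero]
  ring

/-- Watson's lemma for the kernel `t · gaussTail (s t)`: a Taylor polynomial of `q` at `0`
integrates to an expansion in powers of `1 / s`. -/
lemma exists_integral_mul_gaussTail_bound {q : ℝ → ℝ} (hq : HasContinuousIntegrableDerivs q)
    (N : ℕ) :
    ∃ C, ∀ s : ℝ, 0 < s →
      |(∫ t in Ioi 0, q t * (t * gaussTail (s * t))) -
        ∑ n ∈ Finset.range (N + 1),
          derivNonneg n q 0 / n.factorial * (tailMoment (n + 1) / s ^ (n + 2))|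
        ≤ C / s ^ (N + 3) := by
  obtain ⟨hsm, hint⟩ := hq
  have hqi : IntegrableOn q (Ici 0) := by
    refine (hint 0).congr_fun (fun t _ => ?_) measurableSet_Ici
    simp [derivNonneg]
  obtain ⟨C₁, hC₁⟩ := exists_taylor_bound_Ioc hsm N
  set a : ℕ → ℝ := fun n => derivNonneg n q 0 / n.factorial with ha
  set C₂ : ℝ := ∑ n ∈ Finset.range (N + 1), |a n| with hC₂
  have hC₂0 : 0 ≤ C₂ := Finset.sum_nonneg fun _ _ => abs_nonneg _
  set K : ℝ := ((N + 2 : ℕ) + 1) * tailMoment (N + 2) with hK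
  have hK0 : 0 ≤ K := mul_nonneg (by positivity) (tailMoment_nonneg _)
  refine ⟨(|C₁| + C₂) * tailMoment (N + 2) + K * ∫ t in Ioi 0, |q t|, fun s hs => ?_⟩
  have hmon : ∀ n, IntegrableOn (fun t => a n * (t ^ (n + 1) * gaussTail (s * t))) (Ioi 0) :=
    fun n => (integrableOn_pow_mul_gaussTail (n + 1) hs).const_mul _
  have hpoly : ∑ n ∈ Finset.range (N + 1), a n * (tailMoment (n + 1) / s ^ (n + 2)) =
      ∫ t in Ioi 0, ∑ n ∈ Finset.range (N + 1), a n * (t ^ (n + 1) * gaussTail (s * t)) := by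
    rw [integral_finsetSum _ fun n _ => hmon n]
    refine Finset.sum_congr rfl fun n _ => ?_
    rw [integral_const_mul, integral_pow_mul_gaussTail _ hs]
  rw [hpoly, ← integral_sub (integrableOn_mul_gaussTail hqi hs)
    (integrable_finsetSum _ fun n _ => hmon n)]
  have hqa : IntegrableOn (fun t => |q t|) (Ioi 0) := (hqi.mono_set Ioi_subset_Ici_self).abs
  have hb1 := (integrableOn_pow_mul_gaussTail (N + 2) hs).const_mul (|C₁| + C₂)
  have hb2 := hqa.const_mul (K / s ^ (N + 3))
  have hbound := norm_integral_le_of_norm_le (hb1.add hb2)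
    (f := fun t => q t * (t * gaussTail (s * t)) -
      ∑ n ∈ Finset.range (N + 1), a n * (t ^ (n + 1) * gaussTail (s * t)))
    ((ae_restrict_mem measurableSet_Ioi).mono fun t ht => ?_)
  · refine hbound.trans (le_of_eq ?_)
    simp only [Pi.add_apply]
    rw [integral_add hb1 hb2, integral_const_mul, integral_const_mul,
      integral_pow_mul_gaussTail _ hs]
    ring
  · have ht0 : (0 : ℝ) < t := ht
    have hg := gaussTail_nonneg (s * t)
    have hfac : q t * (t * gaussTail (s * t)) -
        ∑ n ∈ Finset.range (N + 1), a n * (t ^ (n + 1) * gaussTail (s * t)) =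
        (q t - ∑ n ∈ Finset.range (N + 1), a n * t ^ n) * (t * gaussTail (s * t)) := by
      rw [sub_mul, Finset.sum_mul]
      congr 1
      exact Finset.sum_congr rfl fun n _ => by ring
    have hpow : t ^ (N + 2) * gaussTail (s * t) = t ^ (N + 1) * (t * gaussTail (s * t)) := by ring
    simp only [Pi.add_apply]
    rw [Real.norm_eq_abs, hfac, abs_mul, abs_of_nonneg (mul_nonneg ht0.le hg), hpow]
    -- beyond `1` the Taylor remainder is not small, but the tail is: it beats every power of `s t`
    rcases le_or_gt t 1 with ht1 | ht1
    · have h1 := hC₁ t ⟨ht0, ht1⟩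
      have h2 : |q t - ∑ n ∈ Finset.range (N + 1), a n * t ^ n| ≤ (|C₁| + C₂) * t ^ (N + 1) :=
        h1.trans (by gcongr; linarith [le_abs_self C₁])
      have h3 : 0 ≤ K / s ^ (N + 3) * |q t| := by positivity
      have h4 := mul_le_mul_of_nonneg_right h2 (mul_nonneg ht0.le hg)
      linarith
    · have h1 : |∑ n ∈ Finset.range (N + 1), a n * t ^ n| ≤ C₂ * t ^ (N + 1) := by
        refine (Finset.abs_sum_le_sum_abs _ _).trans ?_
        rw [hC₂, Finset.sum_mul]
        refine Finset.sum_le_sum fun n hn => ?_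
        rw [abs_mul, abs_of_pos (pow_pos ht0 n)]
        gcongr
        · exact ht1.le
        · exact (Finset.mem_range.1 hn).le
      have h2 : t * gaussTail (s * t) ≤ K / s ^ (N + 3) := by
        have h3 := pow_mul_gaussTail_le (N + 2) (mul_nonneg hs.le ht0.le)
        rw [le_div_iff₀ (by positivity)]
        calc t * gaussTail (s * t) * s ^ (N + 3)
            = t ^ 1 * (s ^ (N + 3) * gaussTail (s * t)) := by ring
          _ ≤ t ^ (N + 3) * (s ^ (N + 3) * gaussTail (s * t)) := by
              gcongr
              · exact ht1.le
              · omega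
          _ = (s * t) ^ (N + 2 + 1) * gaussTail (s * t) := by rw [mul_pow]; ring
          _ ≤ K := h3
      have h4 : |q t - ∑ n ∈ Finset.range (N + 1), a n * t ^ n| ≤
          |q t| + (|C₁| + C₂) * t ^ (N + 1) :=
        (abs_sub _ _).trans (by
          have : 0 ≤ |C₁| * t ^ (N + 1) := by positivity
          linarith)
      have h5 := mul_le_mul_of_nonneg_right h4 (mul_nonneg ht0.le hg)
      have h6 := mul_le_mul_of_nonneg_left h2 (abs_nonneg (q t))
      linarith

/-! ### Pointwise comparison of the weighted error with pairwise errors -/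

section Weighted

variable {ι E : Type*} [Fintype ι] [NormedAddCommGroup E]

lemma norm_centerMass_le [NormedSpace ℝ E] {w : ι → ℝ} (hw : ∀ i, 0 < w i) (z : ι → E) :
    ‖Finset.univ.centerMass w z‖ ≤ ∑ i, ‖z i‖ := by
  rw [Finset.centerMass, Finset.smul_sum]
  refine (norm_sum_le _ _).trans (Finset.sum_le_sum fun i hi => ?_)
  have h1 : w i ≤ ∑ j, w j := Finset.single_le_sum (fun j _ => (hw j).le) hi
  have h2 : 0 < ∑ j, w j := (hw i).trans_le h1
  rw [norm_smul, norm_smul, ← mul_assoc, norm_inv, Real.norm_of_nonneg h2.le,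
    Real.norm_of_nonneg (hw i).le]
  exact mul_le_of_le_one_left (norm_nonneg _) ((inv_mul_le_one₀ h2).2 h1)

/-- The weighted mean minimises the weighted sum of squared distances. -/
lemma sum_sq_dist_centerMass_le [InnerProductSpace ℝ E] [Nonempty ι] {w : ι → ℝ}
    (hw : ∀ i, 0 < w i) (z : ι → E) (b : E) :
    ∑ i, w i * ‖z i - Finset.univ.centerMass w z‖ ^ 2 ≤ ∑ i, w i * ‖z i - b‖ ^ 2 := by
  set m := Finset.univ.centerMass w z with hm
  have hW : 0 < ∑ i, w i := Finset.sum_pos (fun i _ => hw i) Finset.univ_nonempty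
  have hz : ∑ i, w i • (z i - m) = 0 := by
    simp_rw [smul_sub]
    rw [Finset.sum_sub_distrib, ← Finset.sum_smul, hm, Finset.centerMass, smul_smul,
      mul_inv_cancel₀ hW.ne', one_smul, sub_self]
  have hcross : ∑ i, w i * ⟪z i - m, m - b⟫ = 0 := by
    have : ∑ i, w i * ⟪z i - m, m - b⟫ = ⟪∑ i, w i • (z i - m), m - b⟫ := by
      rw [sum_inner]
      exact Finset.sum_congr rfl fun i _ => by rw [real_inner_smul_left]
    rw [this, hz, inner_zero_left]
  have hexp : ∀ i, w i * ‖z i - b‖ ^ 2 =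
      w i * ‖z i - m‖ ^ 2 + 2 * (w i * ⟪z i - m, m - b⟫) + w i * ‖m - b‖ ^ 2 := by
    intro i
    rw [show z i - b = (z i - m) + (m - b) by abel, norm_add_sq_real]
    ring
  simp_rw [hexp]
  rw [Finset.sum_add_distrib, Finset.sum_add_distrib, ← Finset.mul_sum, hcross, mul_zero, add_zero]
  exact le_add_of_nonneg_right (Finset.sum_nonneg fun i _ => mul_nonneg (hw i).le (by positivity))

/-- The sum over ordered pairs `i ≠ j` of `‖zᵢ - zⱼ‖²`, weighted by `wᵢ` if `j` is at least as
likely as `i`: the error budget of the union bound for maximum likelihood detection. -/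
noncomputable def pairwiseError [DecidableEq ι] (w : ι → ℝ) (z : ι → E) : ℝ :=
  ∑ i, ∑ j ∈ Finset.univ.erase i, ‖z i - z j‖ ^ 2 * (if w i ≤ w j then w i else 0)

/-- The weighted mean does at least as well as the most likely point. -/
lemma sum_sq_dist_centerMass_le_pairwiseError [InnerProductSpace ℝ E] [DecidableEq ι] [Nonempty ι]
    {w : ι → ℝ} (hw : ∀ i, 0 < w i) (z : ι → E) :
    ∑ i, w i * ‖z i - Finset.univ.centerMass w z‖ ^ 2 ≤ pairwiseError w z := by
  obtain ⟨k, hk⟩ := Finite.exists_max w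
  refine (sum_sq_dist_centerMass_le hw z (z k)).trans (Finset.sum_le_sum fun i _ => ?_)
  have hnn : ∀ j ∈ Finset.univ.erase i, 0 ≤ ‖z i - z j‖ ^ 2 * (if w i ≤ w j then w i else 0) := by
    intro j _
    have := (hw i).le
    split_ifs <;> positivity
  rcases eq_or_ne k i with rfl | hki
  · simpa using Finset.sum_nonneg hnn
  · refine le_trans (le_of_eq ?_)
      (Finset.single_le_sum hnn (Finset.mem_erase.2 ⟨hki, Finset.mem_univ k⟩))
    rw [if_pos (hk i), mul_comm]

/-- Every estimate `b` incurs a fixed fraction of the pairwise error: it cannot be close to both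
points of a pair, and each point of a pair has at least the smaller weight. -/
lemma pairwiseError_le [DecidableEq ι] {w : ι → ℝ} (hw : ∀ i, 0 < w i) (z : ι → E) (b : E) :
    pairwiseError w z ≤ 4 * ((Fintype.card ι : ℝ) - 1) * ∑ i, w i * ‖z i - b‖ ^ 2 := by
  set e : ι → ℝ := fun i => w i * ‖z i - b‖ ^ 2 with he
  have hterm : ∀ i, ∀ j, ‖z i - z j‖ ^ 2 * (if w i ≤ w j then w i else 0) ≤ 2 * (e i + e j) := by
    intro i j
    have h0 := (hw i).le
    have h0' := (hw j).le
    split_ifs with hij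
    · have htri : ‖z i - z j‖ ≤ ‖z i - b‖ + ‖z j - b‖ := by
        rw [norm_sub_rev (z j) b]; exact norm_sub_le_norm_sub_add_norm_sub _ _ _
      have h1 : ‖z i - z j‖ ^ 2 ≤ 2 * (‖z i - b‖ ^ 2 + ‖z j - b‖ ^ 2) :=
        (pow_le_pow_left₀ (norm_nonneg _) htri 2).trans add_sq_le
      have h2 : w i * ‖z j - b‖ ^ 2 ≤ w j * ‖z j - b‖ ^ 2 := by gcongr
      have h3 := mul_le_mul_of_nonneg_right h1 h0
      simp only [he]
      linarith
    · have h1 : 0 ≤ e i := mul_nonneg h0 (sq_nonneg _)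
      have h2 : 0 ≤ e j := mul_nonneg h0' (sq_nonneg _)
      rw [mul_zero]
      linarith
  have hsum : ∀ f : ι → ℝ, ∀ i, ∑ j ∈ Finset.univ.erase i, f j = (∑ j, f j) - f i := fun f i =>
    Finset.sum_erase_eq_sub (Finset.mem_univ i)
  calc pairwiseError w z
      ≤ ∑ i, ∑ j ∈ Finset.univ.erase i, 2 * (e i + e j) :=
        Finset.sum_le_sum fun i _ => Finset.sum_le_sum fun j _ => hterm i j
    _ = 4 * ((Fintype.card ι : ℝ) - 1) * ∑ i, e i := by
        simp_rw [← Finset.mul_sum, hsum, Finset.sum_sub_distrib, Finset.sum_add_distrib,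
          Finset.sum_const, Finset.card_univ, nsmul_eq_mul, ← Finset.mul_sum]
        ring

end Weighted

/-! ### The law of input and noise -/

section Channel

variable {Ω : Type*} [MeasurableSpace Ω] {P : Measure Ω} {nr nt M : ℕ}
  {x : Ω → CVec nt} {noise : Ω → CVec nr} {c : Fin M → CVec nt}

/-- `x` is uniform on the `M` distinct points `c i`, `noise` is `CN(0, I)`, and both are
independent. -/
structure UniformGaussian (P : Measure Ω) (x : Ω → CVec nt) (noise : Ω → CVec nr)
    (c : Fin M → CVec nt) : Prop where
  measurable_input : Measurable x
  measurable_noise : Measurable noise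
  injective : Function.Injective c
  uniform : ∀ i, P.real (x ⁻¹' {c i}) = 1 / (M : ℝ)
  gaussian : P.map noise = stdCNVec nr
  indep : IndepFun x noise P

@[fun_prop]
lemma continuous_apply (A : CMat nr nt) : Continuous (apply A) :=
  (Matrix.toEuclideanLin A).continuous_of_finiteDimensional

lemma apply_centerMass (A : CMat nr nt) (w : Fin M → ℝ) (c : Fin M → CVec nt) :
    apply A (Finset.univ.centerMass w c) = Finset.univ.centerMass w (fun i => apply A (c i)) := by
  have h : ∀ v, apply A v = (Matrix.toEuclideanLin A).restrictScalars ℝ v := fun v => rfl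
  simp only [Finset.centerMass, h, map_smul, map_sum]

@[fun_prop]
lemma measurable_apply_left (u : CVec nt) : Measurable (fun A : CMat nr nt => apply A u) := by
  refine (WithLp.measurable_toLp 2 _).comp (measurable_pi_lambda _ fun i => ?_)
  simp only [Matrix.mulVec, dotProduct]
  refine Finset.measurable_sum _ fun j _ => Measurable.mul_const ?_ _
  exact (measurable_pi_apply j).comp (measurable_pi_apply (X := fun _ => Fin nt → ℂ) i)

/-- The noiseless output `√snr · A u`. -/
noncomputable def signal (A : CMat nr nt) (snr : ℝ) (u : CVec nt) : CVec nr :=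
  (Real.sqrt snr : ℂ) • apply A u

@[fun_prop]
lemma continuous_signal (A : CMat nr nt) (snr : ℝ) : Continuous (signal A snr) := by
  unfold signal; fun_prop

@[fun_prop]
lemma measurable_signal_left (snr : ℝ) (u : CVec nt) :
    Measurable (fun A : CMat nr nt => signal A snr u) :=
  (continuous_const_smul (Real.sqrt snr : ℂ)).measurable.comp (measurable_apply_left u)

/-- The likelihood of the `i`-th input given the output `y`. -/
noncomputable def likelihood (c : Fin M → CVec nt) (A : CMat nr nt) (snr : ℝ) (y : CVec nr)
    (i : Fin M) : ℝ :=
  gaussDensity nr (y - signal A snr (c i))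

/-- The posterior mean of the input given the output `y`. -/
noncomputable def postMean (c : Fin M → CVec nt) (A : CMat nr nt) (snr : ℝ) (y : CVec nr) :
    CVec nt :=
  Finset.univ.centerMass (likelihood c A snr y) c

lemma likelihood_pos (A : CMat nr nt) (snr : ℝ) (y : CVec nr) (i : Fin M) :
    0 < likelihood c A snr y i := gaussDensity_pos _ _

lemma sum_likelihood_pos [NeZero M] (A : CMat nr nt) (snr : ℝ) (y : CVec nr) :
    0 < ∑ i, likelihood c A snr y i :=
  Finset.sum_pos (fun i _ => likelihood_pos A snr y i) Finset.univ_nonempty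

@[fun_prop]
lemma continuous_postMean [NeZero M] (A : CMat nr nt) (snr : ℝ) :
    Continuous (postMean c A snr) := by
  have h : ∀ i, Continuous fun y => likelihood c A snr y i := fun i => by
    unfold likelihood; fun_prop
  unfold postMean Finset.centerMass
  exact (Continuous.inv₀ (by fun_prop) fun y => (sum_likelihood_pos A snr y).ne').smul
    (by fun_prop)

/-- The joint law of input and noise is a uniform mixture. -/
lemma UniformGaussian.map_eq [IsProbabilityMeasure P] [NeZero M]
    (h : UniformGaussian P x noise c) :
    P.map (fun ω => (x ω, noise ω)) =
      ∑ i, ENNReal.ofReal (1 / (M : ℝ)) • (stdCNVec nr).map (Prod.mk (c i)) := by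
  have hfib : ∀ i, P (x ⁻¹' {c i}) = ENNReal.ofReal (1 / (M : ℝ)) := fun i => by
    rw [← h.uniform i, ofReal_measureReal]
  have hmeas : ∀ i, MeasurableSet (x ⁻¹' {c i}) := fun i =>
    h.measurable_input (measurableSet_singleton _)
  have hdisj : Pairwise (Function.onFun Disjoint fun i => x ⁻¹' {c i}) := fun i j hij =>
    Disjoint.preimage _ (disjoint_singleton.2 (h.injective.ne hij))
  have hM : (M : ℝ) ≠ 0 := NeZero.ne _
  have hfull : (⋃ i, x ⁻¹' {c i}) ∈ ae P := by
    rw [mem_ae_iff_prob_eq_one (MeasurableSet.iUnion hmeas), measure_iUnion hdisj hmeas,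
      tsum_fintype]
    simp_rw [hfib]
    rw [← ENNReal.ofReal_sum_of_nonneg (fun _ _ => by positivity)]
    simp [hM]
  have hlaw : P.map x = ∑ i, ENNReal.ofReal (1 / (M : ℝ)) • Measure.dirac (c i) := by
    ext S hS
    rw [Measure.map_apply h.measurable_input hS, Measure.finsetSum_apply]
    have h1 : P (x ⁻¹' S) = P (⋃ i, x ⁻¹' ({c i} ∩ S)) := by
      refine measure_congr ?_
      filter_upwards [hfull] with ω hω
      refine propext ⟨fun hs => ?_, fun hs => ?_⟩
      · obtain ⟨i, hi⟩ := mem_iUnion.1 hω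
        exact mem_iUnion.2 ⟨i, hi, hs⟩
      · obtain ⟨i, hi⟩ := mem_iUnion.1 hs
        exact hi.2
    rw [h1, measure_iUnion (fun i j hij => (hdisj hij).mono
        (preimage_mono inter_subset_left) (preimage_mono inter_subset_left))
        (fun i => h.measurable_input ((measurableSet_singleton _).inter hS)), tsum_fintype]
    refine Finset.sum_congr rfl fun i _ => ?_
    rw [Measure.smul_apply, Measure.dirac_apply' _ hS, smul_eq_mul]
    by_cases hi : c i ∈ S
    · rw [inter_eq_left.2 (singleton_subset_iff.2 hi), hfib, indicator_of_mem hi]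
      simp
    · rw [singleton_inter_eq_empty.2 hi, indicator_of_notMem hi]
      simp
  rw [(indepFun_iff_map_prod_eq_prod_map_map h.measurable_input.aemeasurable
    h.measurable_noise.aemeasurable).1 h.indep, h.gaussian]
  refine Measure.prod_eq fun S T hS hT => ?_
  rw [hlaw, Measure.finsetSum_apply, Measure.finsetSum_apply, Finset.sum_mul]
  refine Finset.sum_congr rfl fun i _ => ?_
  rw [Measure.smul_apply, Measure.smul_apply, Measure.map_apply (by fun_prop) (hS.prod hT),
    Measure.dirac_apply' _ hS, smul_eq_mul, smul_eq_mul, mul_assoc]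
  congr 1
  by_cases hi : c i ∈ S
  · rw [mk_preimage_prod_right hi, indicator_of_mem hi]; simp
  · rw [mk_preimage_prod_right_eq_empty hi, indicator_of_notMem hi]; simp

section Expectation

variable {E : Type*} [NormedAddCommGroup E]

lemma UniformGaussian.integrable [IsProbabilityMeasure P] [NeZero M]
    (h : UniformGaussian P x noise c) {F : CVec nt × CVec nr → E} (hF : StronglyMeasurable F)
    (hint : ∀ i, Integrable (fun v => F (c i, v)) (stdCNVec nr)) :
    Integrable (fun ω => F (x ω, noise ω)) P := by
  have hxn := (h.measurable_input.prodMk h.measurable_noise).aemeasurable (μ := P)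
  rw [← Function.comp_def F, ← integrable_map_measure hF.aestronglyMeasurable hxn, h.map_eq,
    integrable_finsetSum_measure]
  intro i _
  refine Integrable.smul_measure ?_ ENNReal.ofReal_ne_top
  exact (integrable_map_measure hF.aestronglyMeasurable (by fun_prop)).2 (hint i)

lemma UniformGaussian.integral_eq [NormedSpace ℝ E] [IsProbabilityMeasure P] [NeZero M]
    (h : UniformGaussian P x noise c) {F : CVec nt × CVec nr → E} (hF : StronglyMeasurable F)
    (hint : ∀ i, Integrable (fun v => F (c i, v)) (stdCNVec nr)) :
    ∫ ω, F (x ω, noise ω) ∂P = (1 / (M : ℝ)) • ∑ i, ∫ v, F (c i, v) ∂(stdCNVec nr) := by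
  have hxn := (h.measurable_input.prodMk h.measurable_noise).aemeasurable (μ := P)
  rw [← integral_map hxn hF.aestronglyMeasurable, h.map_eq, integral_finsetSum_measure,
    Finset.smul_sum]
  · refine Finset.sum_congr rfl fun i _ => ?_
    rw [integral_smul_measure, integral_map (by fun_prop) hF.aestronglyMeasurable,
      ENNReal.toReal_ofReal (by positivity)]
  · intro i _
    refine Integrable.smul_measure ?_ ENNReal.ofReal_ne_top
    exact (integrable_map_measure hF.aestronglyMeasurable (by fun_prop)).2 (hint i)

end Expectation

/-! ### The conditional mean estimator -/

lemma norm_postMean_le (A : CMat nr nt) (snr : ℝ) (y : CVec nr) :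
    ‖postMean c A snr y‖ ≤ ∑ i, ‖c i‖ :=
  norm_centerMass_le (likelihood_pos A snr y) c

lemma measurable_output (h : UniformGaussian P x noise c) (A : CMat nr nt) (snr : ℝ) :
    Measurable (output x noise snr A) :=
  Measurable.add ((continuous_signal A snr).measurable.comp h.measurable_input) h.measurable_noise

/-- Bayes' rule: `postMean` evaluated at the output is the conditional mean of the input. On the
preimage of a Borel set `B`, both integrals equal the integral over `B` of the likelihood-weighted
sum of the points `c i`. -/
lemma UniformGaussian.condExp_ae_eq [IsProbabilityMeasure P] [NeZero M]
    (h : UniformGaussian P x noise c) (A : CMat nr nt) (snr : ℝ) :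
    P[x | MeasurableSpace.comap (output x noise snr A) inferInstance] =ᵐ[P]
      fun ω => postMean c A snr (output x noise snr A ω) := by
  have hout := measurable_output h A snr
  have hm := hout.comap_le
  have hxint : Integrable x P :=
    h.integrable (F := Prod.fst) measurable_fst.stronglyMeasurable fun i => integrable_const (c i)
  have hpm : Measurable (postMean c A snr) := (continuous_postMean A snr).measurable
  have hgint : Integrable (fun ω => postMean c A snr (output x noise snr A ω)) P :=
    Integrable.of_bound (hpm.comp hout).aestronglyMeasurable _
      (ae_of_all _ fun ω => norm_postMean_le A snr _)
  refine (ae_eq_condExp_of_forall_setIntegral_eq hm hxint (fun _ _ _ => hgint.integrableOn) ?_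
    ?_).symm
  · rintro _ ⟨B, hB, rfl⟩ -
    have hF1 : Measurable fun q : CVec nt × CVec nr =>
        B.indicator (postMean c A snr) (signal A snr q.1 + q.2) :=
      (hpm.indicator hB).comp (by unfold signal; fun_prop)
    have hF2 : Measurable fun q : CVec nt × CVec nr =>
        B.indicator (fun _ => q.1) (signal A snr q.1 + q.2) := by
      refine Measurable.indicator (s := (fun q : CVec nt × CVec nr => signal A snr q.1 + q.2) ⁻¹' B)
        measurable_fst ?_
      exact hB.preimage (by unfold signal; fun_prop)
    have hI1 : ∀ i, Integrable
        (fun v => B.indicator (postMean c A snr) (signal A snr (c i) + v)) (stdCNVec nr) := by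
      intro i
      refine Integrable.of_bound
        (hF1.comp (measurable_prodMk_left (x := c i))).aestronglyMeasurable (∑ i, ‖c i‖)
        (ae_of_all _ fun v => ?_)
      exact (norm_indicator_le_norm_self _ _).trans (norm_postMean_le A snr _)
    have hI2 : ∀ i, Integrable
        (fun v => B.indicator (fun _ => c i) (signal A snr (c i) + v)) (stdCNVec nr) := by
      intro i
      refine Integrable.of_bound
        (hF2.comp (measurable_prodMk_left (x := c i))).aestronglyMeasurable ‖c i‖
        (ae_of_all _ fun v => ?_)
      exact norm_indicator_le_norm_self _ _
    rw [← integral_indicator (hout hB), ← integral_indicator (hout hB)]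
    have e1 := h.integral_eq hF1.stronglyMeasurable hI1
    have e2 := h.integral_eq hF2.stronglyMeasurable hI2
    refine Eq.trans (Eq.trans e1 ?_) e2.symm
    congr 1
    rw [Finset.sum_congr rfl fun i _ =>
        integral_add_stdCNVec (signal A snr (c i)) (B.indicator (postMean c A snr)),
      Finset.sum_congr rfl fun i _ =>
        integral_add_stdCNVec (signal A snr (c i)) (B.indicator fun _ => c i),
      ← integral_finsetSum _ fun i _ => integrable_gaussDensity_smul _ (hI1 i),
      ← integral_finsetSum _ fun i _ => integrable_gaussDensity_smul _ (hI2 i)]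
    refine integral_congr_ae (ae_of_all _ fun y => ?_)
    by_cases hy : y ∈ B
    · simp only [indicator_of_mem hy]
      rw [← Finset.sum_smul, postMean, Finset.centerMass, smul_smul]
      have hpos := sum_likelihood_pos (c := c) A snr y
      unfold likelihood at hpos ⊢
      rw [mul_inv_cancel₀ hpos.ne', one_smul]
    · simp [indicator_of_notMem hy]
  · exact (hpm.stronglyMeasurable.comp_measurable (comap_measurable _)).aestronglyMeasurable

/-- The squared error of the conditional mean estimator for the input `c i` and the noise `v`. -/
noncomputable def sqErr (c : Fin M → CVec nt) (A : CMat nr nt) (snr : ℝ) (i : Fin M)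
    (v : CVec nr) : ℝ :=
  ‖apply A (c i) - apply A (postMean c A snr (signal A snr (c i) + v))‖ ^ 2

lemma sqErr_le (A : CMat nr nt) (snr : ℝ) (i : Fin M) (v : CVec nr) :
    sqErr c A snr i v ≤ (2 * ∑ j, ‖apply A (c j)‖) ^ 2 := by
  unfold sqErr
  gcongr
  refine (norm_sub_le _ _).trans ?_
  rw [two_mul]
  gcongr
  · exact Finset.single_le_sum (f := fun j => ‖apply A (c j)‖) (fun j _ => norm_nonneg _)
      (Finset.mem_univ i)
  · rw [postMean, apply_centerMass]
    exact norm_centerMass_le (likelihood_pos A snr _) _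

lemma norm_sqErr_le (A : CMat nr nt) (snr : ℝ) (i : Fin M) (v : CVec nr) :
    ‖sqErr c A snr i v‖ ≤ (2 * ∑ j, ‖apply A (c j)‖) ^ 2 := by
  rw [Real.norm_of_nonneg (by unfold sqErr; positivity)]
  exact sqErr_le A snr i v

lemma continuous_sqErr [NeZero M] (A : CMat nr nt) (i : Fin M) :
    Continuous fun q : ℝ × CVec nr => sqErr c A q.1 i q.2 := by
  have h : ∀ j, Continuous fun q : ℝ × CVec nr =>
      likelihood c A q.1 (signal A q.1 (c i) + q.2) j := fun j => by
    unfold likelihood signal; fun_prop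
  have h2 : Continuous fun q : ℝ × CVec nr => postMean c A q.1 (signal A q.1 (c i) + q.2) := by
    unfold postMean Finset.centerMass
    exact (Continuous.inv₀ (by fun_prop) fun q => (sum_likelihood_pos A _ _).ne').smul
      (by fun_prop)
  unfold sqErr
  fun_prop

lemma integrable_sqErr [NeZero M] (A : CMat nr nt) (snr : ℝ) (i : Fin M) :
    Integrable (sqErr c A snr i) (stdCNVec nr) := by
  refine Integrable.of_bound (C := (2 * ∑ j, ‖apply A (c j)‖) ^ 2)
    ((continuous_sqErr A i).comp (Continuous.prodMk_right snr)).aestronglyMeasurable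
    (ae_of_all _ fun v => norm_sqErr_le A snr i v)

lemma UniformGaussian.mmse_eq [IsProbabilityMeasure P] [NeZero M]
    (h : UniformGaussian P x noise c) (A : CMat nr nt) (snr : ℝ) :
    mmse P x noise snr A = 1 / (M : ℝ) * ∑ i, ∫ v, sqErr c A snr i v ∂(stdCNVec nr) := by
  have hF : Measurable fun q : CVec nt × CVec nr =>
      ‖apply A q.1 - apply A (postMean c A snr (signal A snr q.1 + q.2))‖ ^ 2 := by
    have : Continuous (postMean c A snr) := continuous_postMean A snr
    have : Continuous fun q : CVec nt × CVec nr => signal A snr q.1 + q.2 := by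
      unfold signal; fun_prop
    exact Continuous.measurable (by fun_prop)
  have := h.integral_eq hF.stronglyMeasurable (fun i => integrable_sqErr A snr i)
  rw [smul_eq_mul] at this
  refine Eq.trans (integral_congr_ae ?_) this
  filter_upwards [h.condExp_ae_eq A snr] with ω hω
  rw [hω]
  rfl

lemma UniformGaussian.continuous_mmse [IsProbabilityMeasure P] [NeZero M]
    (h : UniformGaussian P x noise c) (A : CMat nr nt) :
    Continuous fun snr => mmse P x noise snr A := by
  have hc : ∀ i v, Continuous fun snr => sqErr c A snr i v := fun i v =>
    Continuous.comp (g := fun q : ℝ × CVec nr => sqErr c A q.1 i q.2)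
      (f := fun snr => (snr, v)) (continuous_sqErr A i) (by fun_prop)
  have hi : ∀ i, Continuous fun snr => ∫ v, sqErr c A snr i v ∂(stdCNVec nr) := fun i =>
    continuous_of_dominated (bound := fun _ => (2 * ∑ j, ‖apply A (c j)‖) ^ 2)
      (fun snr => (integrable_sqErr A snr i).aestronglyMeasurable)
      (fun snr => ae_of_all _ fun v => norm_sqErr_le A snr i v) (integrable_const _)
      (ae_of_all _ fun v => hc i v)
  have hs : Continuous fun snr =>
      1 / (M : ℝ) * ∑ i, ∫ v, sqErr c A snr i v ∂(stdCNVec nr) := by fun_prop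
  exact hs.congr fun snr => (h.mmse_eq A snr).symm

lemma UniformGaussian.measurable_mmse [IsProbabilityMeasure P] [NeZero M]
    (h : UniformGaussian P x noise c) (snr : ℝ) :
    Measurable fun A : CMat nr nt => mmse P x noise snr A := by
  simp_rw [h.mmse_eq]
  refine measurable_const.mul (Finset.measurable_fun_sum _ fun i _ => ?_)
  have hA : ∀ u : CVec nt, Measurable fun q : CMat nr nt × CVec nr => apply q.1 u := fun u =>
    (measurable_apply_left u).comp measurable_fst
  have hlik : ∀ j, Measurable fun q : CMat nr nt × CVec nr =>
      likelihood c q.1 snr (signal q.1 snr (c i) + q.2) j := fun j => by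
    have hs : ∀ u, Measurable fun q : CMat nr nt × CVec nr => signal q.1 snr u := fun u =>
      (measurable_signal_left snr u).comp measurable_fst
    exact (continuous_gaussDensity nr).measurable.comp
      (((hs (c i)).add measurable_snd).sub (hs (c j)))
  have hF : Measurable fun q : CMat nr nt × CVec nr => sqErr c q.1 snr i q.2 := by
    simp only [sqErr, postMean, apply_centerMass]
    unfold Finset.centerMass
    refine Measurable.pow_const (Measurable.norm ((hA _).sub ?_)) 2
    exact (Measurable.inv (Finset.measurable_fun_sum _ fun j _ => hlik j)).smul
      (Finset.measurable_fun_sum _ fun j _ => (hlik j).smul (hA _))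
  exact (hF.stronglyMeasurable.integral_prod_right (ν := stdCNVec nr)).measurable

/-! ### The minimum mean-square error and pairwise error probabilities -/

/-- The sum of `δ² · gaussTail (snr δ²)` over the ordered pairs `i ≠ j`, where `δ` is the distance
of the noiseless outputs `A cᵢ` and `A cⱼ`. -/
noncomputable def pairTail (c : Fin M → CVec nt) (A : CMat nr nt) (snr : ℝ) : ℝ :=
  ∑ i, ∑ j ∈ Finset.univ.erase i,
    sqDist A (c i) (c j) * gaussTail (snr * sqDist A (c i) (c j))

lemma gaussDensity_smul_indicator (A : CMat nr nt) (snr : ℝ) (i j : Fin M) (y : CVec nr) :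
    gaussDensity nr (y - signal A snr (c i)) •
      {y | ‖y - signal A snr (c j)‖ ≤ ‖y - signal A snr (c i)‖}.indicator (fun _ => (1 : ℝ)) y =
    if likelihood c A snr y i ≤ likelihood c A snr y j then likelihood c A snr y i else 0 := by
  unfold likelihood
  simp only [gaussDensity_le_iff]
  by_cases hy : ‖y - signal A snr (c j)‖ ≤ ‖y - signal A snr (c i)‖
  · rw [indicator_of_mem (by exact hy), if_pos hy, smul_eq_mul, mul_one]
  · rw [indicator_of_notMem (by exact hy), if_neg hy, smul_zero]

lemma measurableSet_closer (a b : CVec nr) : MeasurableSet {y | ‖y - b‖ ≤ ‖y - a‖} :=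
  measurableSet_le (by fun_prop) (by fun_prop)

lemma integrable_indicator_closer (a b : CVec nr) :
    Integrable (fun v => {y | ‖y - b‖ ≤ ‖y - a‖}.indicator (fun _ => (1 : ℝ)) (a + v))
      (stdCNVec nr) := by
  refine Integrable.of_bound (C := 1) (Measurable.aestronglyMeasurable ?_)
    (ae_of_all _ fun v => ?_)
  · exact (measurable_const.indicator (measurableSet_closer a b)).comp (by fun_prop)
  · exact (norm_indicator_le_norm_self _ _).trans (by simp)

lemma integrable_likelihood_ite (A : CMat nr nt) (snr : ℝ) (i j : Fin M) :
    Integrable fun y => if likelihood c A snr y i ≤ likelihood c A snr y j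
      then likelihood c A snr y i else 0 := by
  simp_rw [← gaussDensity_smul_indicator]
  exact integrable_gaussDensity_smul _ (integrable_indicator_closer _ _)

/-- The probability that input `j` is at least as likely as the transmitted `i` is a Gaussian
tail. The factor `sqDist` covers the case of coinciding noiseless outputs, where that probability
is `1` but `gaussTail 0` is `1/2`. -/
lemma sqDist_mul_integral_likelihood_ite (A : CMat nr nt) {snr : ℝ} (hs : 0 < snr) (i j : Fin M) :
    sqDist A (c i) (c j) * ∫ y, (if likelihood c A snr y i ≤ likelihood c A snr y j
      then likelihood c A snr y i else 0) =
    sqDist A (c i) (c j) * gaussTail (snr * sqDist A (c i) (c j)) := by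
  by_cases hab : apply A (c i) = apply A (c j)
  · simp [sqDist, hab]
  congr 1
  have hsq : (Real.sqrt snr : ℂ) ≠ 0 := by exact_mod_cast (Real.sqrt_pos.2 hs).ne'
  have hne : signal A snr (c i) ≠ signal A snr (c j) := fun hh =>
    hab (smul_right_injective _ hsq hh)
  have hdist : snr * sqDist A (c i) (c j) = ‖signal A snr (c i) - signal A snr (c j)‖ ^ 2 := by
    rw [sqDist, signal, signal, ← smul_sub, norm_smul, mul_pow, Complex.norm_real,
      Real.norm_of_nonneg (Real.sqrt_nonneg _), Real.sq_sqrt hs.le]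
  simp_rw [← gaussDensity_smul_indicator]
  rw [← integral_add_stdCNVec, hdist, ← stdCNVec_real_halfSpace hne]
  set a := signal A snr (c i)
  set b := signal A snr (c j)
  have hset : ∀ v, {y | ‖y - b‖ ≤ ‖y - a‖}.indicator (fun _ => (1 : ℝ)) (a + v) =
      {v | ‖a + v - b‖ ≤ ‖v‖}.indicator (fun _ => (1 : ℝ)) v := by
    intro v
    simp [indicator]
  simp_rw [hset]
  rw [integral_indicator (measurableSet_le (by fun_prop) (by fun_prop))]
  simp

lemma integral_pairwiseError (A : CMat nr nt) {snr : ℝ} (hs : 0 < snr) :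
    Integrable (fun y => pairwiseError (likelihood c A snr y) fun i => apply A (c i)) ∧
    ∫ y, pairwiseError (likelihood c A snr y) (fun i => apply A (c i)) = pairTail c A snr := by
  have hi : ∀ i j, Integrable fun y => sqDist A (c i) (c j) *
      (if likelihood c A snr y i ≤ likelihood c A snr y j then likelihood c A snr y i else 0) :=
    fun i j => (integrable_likelihood_ite A snr i j).const_mul _
  have hi2 : ∀ i, Integrable fun y => ∑ j ∈ Finset.univ.erase i, sqDist A (c i) (c j) *
      (if likelihood c A snr y i ≤ likelihood c A snr y j then likelihood c A snr y i else 0) :=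
    fun i => integrable_finsetSum _ fun j _ => hi i j
  refine ⟨integrable_finsetSum _ fun i _ => hi2 i, ?_⟩
  refine (integral_finsetSum _ fun i _ => hi2 i).trans (Finset.sum_congr rfl fun i _ => ?_)
  rw [integral_finsetSum _ fun j _ => hi i j]
  refine Finset.sum_congr rfl fun j _ => ?_
  rw [integral_const_mul, sqDist_mul_integral_likelihood_ite A hs]

/-- The mean-square error as one integral over the output. -/
lemma UniformGaussian.mmse_eq_integral [IsProbabilityMeasure P] [NeZero M]
    (h : UniformGaussian P x noise c) (A : CMat nr nt) (snr : ℝ) :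
    Integrable (fun y => ∑ i, likelihood c A snr y i * ‖apply A (c i) -
        Finset.univ.centerMass (likelihood c A snr y) (fun j => apply A (c j))‖ ^ 2) ∧
    mmse P x noise snr A = 1 / (M : ℝ) * ∫ y, ∑ i, likelihood c A snr y i * ‖apply A (c i) -
        Finset.univ.centerMass (likelihood c A snr y) (fun j => apply A (c j))‖ ^ 2 := by
  have hi := fun i => integrable_gaussDensity_smul (signal A snr (c i))
    (F := fun y => ‖apply A (c i) - apply A (postMean c A snr y)‖ ^ 2)
    (integrable_sqErr (c := c) A snr i)
  have he := fun i => integral_add_stdCNVec (signal A snr (c i))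
    (fun y => ‖apply A (c i) - apply A (postMean c A snr y)‖ ^ 2)
  simp only [postMean, apply_centerMass, smul_eq_mul] at hi he
  refine ⟨integrable_finsetSum _ fun i _ => hi i, ?_⟩
  rw [h.mmse_eq]
  refine congrArg _ (Eq.trans ?_ (integral_finsetSum _ fun i _ => hi i).symm)
  refine Finset.sum_congr rfl fun i _ => ?_
  rw [← he i]
  simp only [sqErr, postMean, apply_centerMass]

lemma UniformGaussian.mmse_le [IsProbabilityMeasure P] [NeZero M]
    (h : UniformGaussian P x noise c) (A : CMat nr nt) {snr : ℝ} (hs : 0 < snr) :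
    mmse P x noise snr A ≤ 1 / (M : ℝ) * pairTail c A snr := by
  obtain ⟨h1, h2⟩ := h.mmse_eq_integral A snr
  obtain ⟨h3, h4⟩ := integral_pairwiseError (c := c) A hs
  rw [h2, ← h4]
  gcongr ?_ * ?_
  exact integral_mono h1 h3 fun y =>
    sum_sq_dist_centerMass_le_pairwiseError (likelihood_pos A snr y) _

lemma UniformGaussian.pairTail_le_mmse [IsProbabilityMeasure P] [NeZero M]
    (h : UniformGaussian P x noise c) (A : CMat nr nt) {snr : ℝ} (hs : 0 < snr) :
    pairTail c A snr ≤ 4 * (M : ℝ) * ((M : ℝ) - 1) * mmse P x noise snr A := by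
  obtain ⟨h1, h2⟩ := h.mmse_eq_integral A snr
  obtain ⟨h3, h4⟩ := integral_pairwiseError (c := c) A hs
  have hM : (M : ℝ) ≠ 0 := NeZero.ne _
  have h5 := integral_mono h3 (h1.const_mul (4 * ((M : ℝ) - 1))) fun y => by
    have := pairwiseError_le (likelihood_pos (c := c) A snr y) (fun i => apply A (c i))
      (Finset.univ.centerMass (likelihood c A snr y) (fun j => apply A (c j)))
    rwa [Fintype.card_fin] at this
  rw [h4, integral_const_mul] at h5
  refine h5.trans (le_of_eq ?_)
  rw [h2]
  field_simp

end Channel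

/-! ### Averaging over the channel -/

section Average

variable {Ω : Type*} [MeasurableSpace Ω] {P : Measure Ω} {nr nt M : ℕ}
  {H : Ω → CMat nr nt} {x : Ω → CVec nt} {noise : Ω → CVec nr} {c : Fin M → CVec nt}
  {p : Fin M → Fin M → ℝ → ℝ}

lemma measurable_sqDist (hH : Measurable H) (u v : CVec nt) :
    Measurable fun ω => sqDist (H ω) u v := by
  unfold sqDist
  have h := ((measurable_apply_left u).comp hH).sub ((measurable_apply_left v).comp hH)
  exact h.norm.pow_const 2

lemma sqDist_nonneg (A : CMat nr nt) (u v : CVec nt) : 0 ≤ sqDist A u v := sq_nonneg _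

lemma pairTail_nonneg (A : CMat nr nt) (snr : ℝ) : 0 ≤ pairTail c A snr :=
  Finset.sum_nonneg fun _ _ => Finset.sum_nonneg fun _ _ =>
    mul_nonneg (sqDist_nonneg _ _ _) (gaussTail_nonneg _)

lemma pairTail_le (A : CMat nr nt) {snr : ℝ} (hs : 0 < snr) :
    pairTail c A snr ≤ ∑ i : Fin M, ∑ _j ∈ Finset.univ.erase i, tailMoment 0 / snr :=
  Finset.sum_le_sum fun _ _ => Finset.sum_le_sum fun _ _ =>
    mul_gaussTail_le hs (sqDist_nonneg _ _ _)

lemma integrable_sqDist_mul_gaussTail [IsFiniteMeasure P] (hH : Measurable H) {snr : ℝ}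
    (hs : 0 < snr) (u v : CVec nt) :
    Integrable (fun ω => sqDist (H ω) u v * gaussTail (snr * sqDist (H ω) u v)) P := by
  have hm := measurable_sqDist hH u v
  refine Integrable.of_bound (C := tailMoment 0 / snr) (by fun_prop) (ae_of_all _ fun ω => ?_)
  rw [Real.norm_of_nonneg (mul_nonneg (sqDist_nonneg _ _ _) (gaussTail_nonneg _))]
  exact mul_gaussTail_le hs (sqDist_nonneg _ _ _)

lemma integrable_pairTail [IsFiniteMeasure P] (hH : Measurable H) {snr : ℝ} (hs : 0 < snr) :
    Integrable (fun ω => pairTail c (H ω) snr) P :=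
  integrable_finsetSum _ fun _ _ => integrable_finsetSum _ fun _ _ =>
    integrable_sqDist_mul_gaussTail hH hs _ _

lemma integral_mul_gaussTail_of_pdf {D : Ω → ℝ} (hD : Measurable D) {q : ℝ → ℝ}
    (hpdf : IsPdfOnNonneg P D q) (hq : HasContinuousIntegrableDerivs q) (snr : ℝ) :
    ∫ ω, D ω * gaussTail (snr * D ω) ∂P = ∫ t in Ioi 0, q t * (t * gaussTail (snr * t)) := by
  have hqm : AEMeasurable q (volume.restrict (Ici 0)) :=
    hq.1.continuousOn.aemeasurable measurableSet_Ici
  rw [← integral_map (f := fun t => t * gaussTail (snr * t)) hD.aemeasurable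
    (Measurable.aestronglyMeasurable (by fun_prop)), hpdf.2,
    integral_withDensity_eq_integral_toReal_smul₀ hqm.ennreal_ofReal (by simp),
    integral_Ici_eq_integral_Ioi]
  refine setIntegral_congr_fun measurableSet_Ioi fun t ht => ?_
  rw [ENNReal.toReal_ofReal (hpdf.1 t (Ioi_subset_Ici_self ht)), smul_eq_mul]

lemma pairSum_eq_zero_of_lt {n : ℕ} (hn : n < order p - 1) : pairSum p n = 0 := by
  rw [order, Nat.add_sub_cancel_left] at hn
  by_contra h
  exact Nat.notMem_of_lt_sInf hn h

/-- The factor `n 4ⁿ Γ(n + 3/2) / (√π Γ(n + 2))`, common to `kLB` and `kUB`. -/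
noncomputable def kCommon (n : ℕ) : ℝ :=
  ((n : ℝ) * 4 ^ n / Real.sqrt Real.pi) *
    (Real.Gamma ((n : ℝ) + 3 / 2) / Real.Gamma ((n : ℝ) + 2))

lemma tailMoment_div_factorial (N : ℕ) :
    tailMoment (N + 1) / N.factorial = 2 * kCommon (N + 1) := by
  have h1 : ((N + 1 : ℕ) : ℝ) + 2 = ((N + 2 : ℕ) : ℝ) + 1 := by push_cast; ring
  rw [tailMoment, kCommon, h1, Real.Gamma_nat_eq_factorial, Nat.factorial_succ, Nat.factorial_succ]
  have h2 : (N.factorial : ℝ) ≠ 0 := by exact_mod_cast N.factorial_ne_zero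
  have h3 : ((N : ℝ) + 1) ≠ 0 := by positivity
  have h4 : ((N : ℝ) + 1 + 1) ≠ 0 := by positivity
  push_cast
  field_simp

/-- The averaged pairwise tail decays like `2 kCommon d S_{d-1} / snr^(d+1)`: the terms of lower
order in the expansion cancel in the sum over all pairs. -/
lemma exists_integral_pairTail_bound [IsProbabilityMeasure P] (hH : Measurable H)
    (hp : ∀ i j, i ≠ j → IsPdfOnNonneg P (fun ω => sqDist (H ω) (c i) (c j)) (p i j))
    (hsmooth : ∀ i j, i ≠ j → HasContinuousIntegrableDerivs (p i j)) :
    ∃ C, ∀ snr : ℝ, 0 < snr →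
      |(∫ ω, pairTail c (H ω) snr ∂P) -
        2 * kCommon (order p) * pairSum p (order p - 1) / snr ^ (order p + 1)|
        ≤ C / snr ^ (order p + 2) := by
  obtain ⟨N, hN⟩ : ∃ N, order p = N + 1 := ⟨sInf {n : ℕ | pairSum p n ≠ 0}, by
    rw [order, add_comm]⟩
  have hex : ∀ i j, ∃ C, i ≠ j → ∀ s : ℝ, 0 < s →
      |(∫ t in Ioi 0, p i j t * (t * gaussTail (s * t))) -
        ∑ n ∈ Finset.range (N + 1),
          derivNonneg n (p i j) 0 / n.factorial * (tailMoment (n + 1) / s ^ (n + 2))|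
        ≤ C / s ^ (N + 3) := by
    intro i j
    by_cases hij : i = j
    · exact ⟨0, fun h => absurd hij h⟩
    · obtain ⟨C, hC⟩ := exists_integral_mul_gaussTail_bound (hsmooth i j hij) N
      exact ⟨C, fun _ => hC⟩
  choose C hC using hex
  refine ⟨∑ i, ∑ j ∈ Finset.univ.erase i, C i j, fun s hs => ?_⟩
  have hT : ∫ ω, pairTail c (H ω) s ∂P = ∑ i, ∑ j ∈ Finset.univ.erase i,
      ∫ t in Ioi 0, p i j t * (t * gaussTail (s * t)) := by
    unfold pairTail
    rw [integral_finsetSum _ fun i _ => integrable_finsetSum _ fun j _ =>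
      integrable_sqDist_mul_gaussTail hH hs _ _]
    refine Finset.sum_congr rfl fun i _ => ?_
    rw [integral_finsetSum _ fun j _ => integrable_sqDist_mul_gaussTail hH hs _ _]
    refine Finset.sum_congr rfl fun j hj => ?_
    have hij : i ≠ j := (Finset.ne_of_mem_erase hj).symm
    exact integral_mul_gaussTail_of_pdf (measurable_sqDist hH _ _) (hp i j hij)
      (hsmooth i j hij) s
  have hswap : ∑ i, ∑ j ∈ Finset.univ.erase i, ∑ n ∈ Finset.range (N + 1),
      derivNonneg n (p i j) 0 / n.factorial * (tailMoment (n + 1) / s ^ (n + 2)) =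
      ∑ n ∈ Finset.range (N + 1),
        pairSum p n / n.factorial * (tailMoment (n + 1) / s ^ (n + 2)) := by
    rw [Finset.sum_congr rfl fun i _ => Finset.sum_comm, Finset.sum_comm]
    refine Finset.sum_congr rfl fun n _ => ?_
    simp_rw [pairSum, ← Finset.sum_mul, ← Finset.sum_div]
  have hmain : 2 * kCommon (order p) * pairSum p (order p - 1) / s ^ (order p + 1) =
      ∑ i, ∑ j ∈ Finset.univ.erase i, ∑ n ∈ Finset.range (N + 1),
        derivNonneg n (p i j) 0 / n.factorial * (tailMoment (n + 1) / s ^ (n + 2)) := by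
    rw [hswap, Finset.sum_range_succ, Finset.sum_eq_zero, zero_add, hN, ← tailMoment_div_factorial,
      Nat.add_sub_cancel]
    · ring
    · intro n hn
      rw [pairSum_eq_zero_of_lt (by rw [hN]; simpa using hn), zero_div, zero_mul]
  rw [hT, hmain, ← Finset.sum_sub_distrib, hN, Finset.sum_div]
  refine (Finset.abs_sum_le_sum_abs _ _).trans (Finset.sum_le_sum fun i _ => ?_)
  rw [← Finset.sum_sub_distrib, Finset.sum_div]
  refine (Finset.abs_sum_le_sum_abs _ _).trans (Finset.sum_le_sum fun j hj => ?_)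
  exact hC i j (Finset.ne_of_mem_erase hj).symm s hs

lemma mmse_nonneg (snr : ℝ) (A : CMat nr nt) : 0 ≤ mmse P x noise snr A :=
  integral_nonneg fun _ => by positivity

/-- A bound uniform in the channel matrix, so that the average over the channel is finite although
the distances `sqDist (H ω) (c i) (c j)` need not be integrable. -/
lemma UniformGaussian.mmse_le_div [IsProbabilityMeasure P] [NeZero M]
    (h : UniformGaussian P x noise c) :
    ∃ B, ∀ (A : CMat nr nt) (snr : ℝ), 0 < snr → mmse P x noise snr A ≤ B / snr := by
  refine ⟨1 / (M : ℝ) * ∑ i : Fin M, ∑ _j ∈ Finset.univ.erase i, tailMoment 0,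
    fun A snr hs => (h.mmse_le A hs).trans ?_⟩
  rw [mul_div_assoc, Finset.sum_div]
  simp_rw [Finset.sum_div]
  gcongr
  exact pairTail_le A hs

lemma UniformGaussian.integrable_mmse [IsProbabilityMeasure P] [NeZero M]
    (h : UniformGaussian P x noise c) (hH : Measurable H) {snr : ℝ} (hs : 0 < snr) :
    Integrable (fun ω => mmse P x noise snr (H ω)) P := by
  obtain ⟨B, hB⟩ := h.mmse_le_div
  refine Integrable.of_bound (C := B / snr)
    ((h.measurable_mmse snr).comp hH).aestronglyMeasurable (ae_of_all _ fun ω => ?_)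
  rw [Real.norm_of_nonneg (mmse_nonneg _ _)]
  exact hB _ _ hs

lemma UniformGaussian.continuousOn_avgMmse [IsProbabilityMeasure P] [NeZero M]
    (h : UniformGaussian P x noise c) (hH : Measurable H) :
    ContinuousOn (avgMmse P H x noise) (Ioi 0) := by
  obtain ⟨B, hB⟩ := h.mmse_le_div
  intro s hs
  have hs0 : (0 : ℝ) < s := hs
  refine ContinuousAt.continuousWithinAt ?_
  refine continuousAt_of_dominated (bound := fun _ => |B| / (s / 2))
    (Eventually.of_forall fun snr => ((h.measurable_mmse snr).comp hH).aestronglyMeasurable)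
    ?_ (integrable_const _) (ae_of_all _ fun ω => (h.continuous_mmse (H ω)).continuousAt)
  filter_upwards [Ioi_mem_nhds (half_lt_self hs0)] with snr hsnr
  have h2 : s / 2 < snr := hsnr
  refine ae_of_all _ fun ω => ?_
  rw [Real.norm_of_nonneg (mmse_nonneg _ _)]
  exact (hB _ _ ((half_pos hs0).trans h2)).trans
    (div_le_div₀ (abs_nonneg _) (le_abs_self _) (half_pos hs0) h2.le)

lemma UniformGaussian.avgMmse_bounds [IsProbabilityMeasure P] [NeZero M]
    (h : UniformGaussian P x noise c) (hH : Measurable H) {snr : ℝ} (hs : 0 < snr) :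
    ∫ ω, pairTail c (H ω) snr ∂P ≤ 4 * (M : ℝ) * ((M : ℝ) - 1) * avgMmse P H x noise snr ∧
      avgMmse P H x noise snr ≤ 1 / (M : ℝ) * ∫ ω, pairTail c (H ω) snr ∂P := by
  rw [avgMmse, ← integral_const_mul, ← integral_const_mul]
  exact ⟨integral_mono (integrable_pairTail hH hs) ((h.integrable_mmse hH hs).const_mul _)
      fun ω => h.pairTail_le_mmse (H ω) hs,
    integral_mono (h.integrable_mmse hH hs) ((integrable_pairTail hH hs).const_mul _)
      fun ω => h.mmse_le (H ω) hs⟩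

end Average

/-! ### Smooth approximation and limits -/

/-- A continuous function on `[1, ∞)` is within `1 / x` of a globally smooth function; clamping to
`[L, U]` is respected because the constraints are convex. -/
lemma exists_contDiff_near_clamp {f : ℝ → ℝ} (hf : ContinuousOn f (Ici 1)) {L U : ℝ}
    (hLU : L ≤ U) :
    ∃ ε : ℝ → ℝ, ContDiff ℝ (⊤ : ℕ∞) ε ∧
      ∀ s, 1 ≤ s → L ≤ ε s ∧ ε s ≤ U ∧ |ε s - max L (min (f s) U)| ≤ 1 / s := by
  have hf' : Continuous fun s => f (max s 1) :=
    hf.comp_continuous (by fun_prop) fun s => le_max_right s 1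
  set g : ℝ → ℝ := fun s => max L (min (f (max s 1)) U) with hg
  have hgc : Continuous g := continuous_const.max (hf'.min continuous_const)
  obtain ⟨ε, hε⟩ := exists_contMDiffMap_forall_mem_convex_of_local_const (n := (⊤ : ℕ∞))
    (modelWithCornersSelf ℝ ℝ) (t := fun s => Icc L U ∩ Metric.ball (g s) (1 / max s 1))
    (fun s => (convex_Icc L U).inter (convex_ball _ _)) (fun s => ⟨g s, by
      have h1 : g s ∈ Icc L U := ⟨le_max_left _ _, max_le hLU (min_le_right _ _)⟩
      have h2 : ∀ᶠ r in 𝓝 s, dist (g s) (g r) < 1 / max r 1 := by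
        have hc1 : Continuous fun r => dist (g s) (g r) := by fun_prop
        have hc2 : Continuous fun r : ℝ => 1 / max r 1 :=
          continuous_const.div (by fun_prop) fun r => (lt_max_of_lt_right one_pos).ne'
        refine hc1.continuousAt.eventually_lt hc2.continuousAt ?_
        rw [dist_self]
        exact one_div_pos.2 (lt_max_of_lt_right one_pos)
      filter_upwards [h2] with r hr
      exact ⟨h1, hr⟩⟩)
  refine ⟨ε, ε.contMDiff.contDiff, fun s hs => ?_⟩
  obtain ⟨⟨h1, h2⟩, h3⟩ := hε s
  refine ⟨h1, h2, ?_⟩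
  simp only [hg, max_eq_left hs] at h3
  exact (Real.dist_eq _ _ ▸ Metric.mem_ball.1 h3).le

lemma limsup_le_limsup_of_tendsto_sub {u v : ℝ → ℝ} {L U : ℝ}
    (hv : ∀ᶠ s in atTop, v s ∈ Icc L U)
    (huv : Tendsto (fun s => u s - v s) atTop (𝓝 0)) :
    limsup u atTop ≤ limsup v atTop := by
  have h := limsup_add_le (f := atTop) (u := v) (v := fun s => u s - v s)
    ⟨L, by simpa using hv.mono fun s hs => hs.1⟩ ⟨U, by simpa using hv.mono fun s hs => hs.2⟩
    huv.isCoboundedUnder_le huv.isBoundedUnder_le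
  rw [huv.limsup_eq, add_zero] at h
  have : v + (fun s => u s - v s) = u := by ext s; simp
  rwa [this] at h

lemma limsup_eq_of_tendsto_sub {u v : ℝ → ℝ} {L U : ℝ}
    (hu : ∀ᶠ s in atTop, u s ∈ Icc L U) (hv : ∀ᶠ s in atTop, v s ∈ Icc L U)
    (huv : Tendsto (fun s => u s - v s) atTop (𝓝 0)) :
    limsup u atTop = limsup v atTop :=
  le_antisymm (limsup_le_limsup_of_tendsto_sub hv huv)
    (limsup_le_limsup_of_tendsto_sub hu (by simpa using huv.neg))

lemma liminf_le_liminf_of_tendsto_sub {u v : ℝ → ℝ} {L U : ℝ}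
    (hv : ∀ᶠ s in atTop, v s ∈ Icc L U)
    (huv : Tendsto (fun s => u s - v s) atTop (𝓝 0)) :
    liminf v atTop ≤ liminf u atTop := by
  have h := le_liminf_add (f := atTop) (u := v) (v := fun s => u s - v s)
    ⟨L, by simpa using hv.mono fun s hs => hs.1⟩ ⟨U, by simpa using hv.mono fun s hs => hs.2⟩
    huv.isBoundedUnder_ge huv.isCoboundedUnder_ge
  rw [huv.liminf_eq, add_zero] at h
  have : v + (fun s => u s - v s) = u := by ext s; simp
  rwa [this] at h

lemma liminf_eq_of_tendsto_sub {u v : ℝ → ℝ} {L U : ℝ}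
    (hu : ∀ᶠ s in atTop, u s ∈ Icc L U) (hv : ∀ᶠ s in atTop, v s ∈ Icc L U)
    (huv : Tendsto (fun s => u s - v s) atTop (𝓝 0)) :
    liminf u atTop = liminf v atTop :=
  le_antisymm (liminf_le_liminf_of_tendsto_sub hu (by simpa using huv.neg))
    (liminf_le_liminf_of_tendsto_sub hv huv)

lemma abs_sub_clamp_le {y L U r : ℝ} (hr : 0 ≤ r) (hLU : L ≤ U) (h1 : L - r ≤ y) (h2 : y ≤ U + r) :
    |y - max L (min y U)| ≤ r := by
  rw [abs_le]
  rcases le_total y U with hU | hU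
  · rw [min_eq_left hU]
    rcases le_total y L with hL | hL
    · rw [max_eq_left hL]; constructor <;> linarith
    · rw [max_eq_right hL]; constructor <;> linarith
  · rw [min_eq_right hU, max_eq_right hLU]; constructor <;> linarith

/-- A function that is continuous on `(0, ∞)` and asymptotically between `L` and `U`, up to
`O(1 / s)`, is within `O(1 / s)` of a smooth function with values between `L` and `U`. -/
lemma exists_smooth_coefficient {f : ℝ → ℝ} (hf : ContinuousOn f (Ioi 0)) {L U C : ℝ}
    (hLU : L ≤ U) (hC : 0 ≤ C) (h1 : ∀ s, 0 < s → L - C / s ≤ f s)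
    (h2 : ∀ s, 0 < s → f s ≤ U + C / s) :
    ∃ ε : ℝ → ℝ, ContDiff ℝ (⊤ : ℕ∞) ε ∧ (∀ s, 1 ≤ s → L ≤ ε s ∧ ε s ≤ U) ∧
      (∀ s, 1 ≤ s → |f s - ε s| ≤ (C + 1) / s) ∧
      limsup ε atTop = limsup f atTop ∧ liminf ε atTop = liminf f atTop := by
  obtain ⟨ε, hε, hb⟩ := exists_contDiff_near_clamp
    (hf.mono fun s (hs : 1 ≤ s) => (zero_lt_one.trans_le hs : 0 < s)) hLU
  have hclose : ∀ s, 1 ≤ s → |f s - ε s| ≤ (C + 1) / s := by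
    intro s hs
    have hs0 : 0 < s := zero_lt_one.trans_le hs
    have h3 := abs_sub_clamp_le (div_nonneg hC hs0.le) hLU (h1 s hs0) (h2 s hs0)
    have h4 := (hb s hs).2.2
    rw [abs_sub_comm] at h4
    rw [add_div]
    exact (abs_sub_le _ _ _).trans (add_le_add h3 h4)
  have hlim : Tendsto (fun s => ε s - f s) atTop (𝓝 0) := by
    refine squeeze_zero_norm' ?_ (tendsto_const_nhds (x := C + 1) |>.div_atTop tendsto_id)
    filter_upwards [eventually_ge_atTop 1] with s hs
    rw [Real.norm_eq_abs, abs_sub_comm]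
    exact hclose s hs
  have hεm : ∀ᶠ s in atTop, ε s ∈ Icc (L - C) (U + C) := by
    filter_upwards [eventually_ge_atTop 1] with s hs
    exact ⟨by linarith [(hb s hs).1], by linarith [(hb s hs).2.1]⟩
  have hfm : ∀ᶠ s in atTop, f s ∈ Icc (L - C) (U + C) := by
    filter_upwards [eventually_ge_atTop 1] with s hs
    have hs0 : 0 < s := zero_lt_one.trans_le hs
    have h5 : C / s ≤ C := div_le_self hC hs
    exact ⟨by linarith [h1 s hs0], by linarith [h2 s hs0]⟩
  exact ⟨ε, hε, fun s hs => ⟨(hb s hs).1, (hb s hs).2.1⟩, hclose,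
    limsup_eq_of_tendsto_sub hεm hfm hlim, liminf_eq_of_tendsto_sub hεm hfm hlim⟩

lemma two_le_of_pairSum_ne_zero {M : ℕ} {p : Fin M → Fin M → ℝ → ℝ}
    (hd : ∃ n : ℕ, pairSum p n ≠ 0) : 2 ≤ M := by
  obtain ⟨n, hn⟩ := hd
  by_contra hM
  have : Subsingleton (Fin M) := Fin.subsingleton_iff_le_one.2 (by omega)
  refine hn (Finset.sum_eq_zero fun i _ => Finset.sum_eq_zero fun j hj => ?_)
  exact absurd (Subsingleton.elim j i) (Finset.ne_of_mem_erase hj)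

end FadingMMSE

theorem theorem1
    {Ω : Type*} [MeasurableSpace Ω] (P : Measure Ω) [IsProbabilityMeasure P]
    {nr nt M : ℕ}
    (H : Ω → FadingMMSE.CMat nr nt) (x : Ω → FadingMMSE.CVec nt)
    (noise : Ω → FadingMMSE.CVec nr)
    (hH : Measurable H) (hx : Measurable x) (hnoise : Measurable noise)
    -- equiprobable input from a constellation of `M` points
    (c : Fin M → FadingMMSE.CVec nt) (hc : Function.Injective c)
    (hunif : ∀ i, P.real (x ⁻¹' {c i}) = 1 / (M : ℝ))
    -- standard circularly symmetric complex Gaussian noise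
    (hgauss : P.map noise = FadingMMSE.stdCNVec nr)
    -- input, noise and channel are independent
    (hindep : IndepFun x noise P)
    (hindepH : IndepFun H (fun ω => (x ω, noise ω)) P)
    -- densities of the squared pairwise distances
    (p : Fin M → Fin M → ℝ → ℝ)
    (hp : ∀ i j, i ≠ j →
      FadingMMSE.IsPdfOnNonneg P (fun ω => FadingMMSE.sqDist (H ω) (c i) (c j)) (p i j))
    (hsmooth : ∀ i j, i ≠ j → FadingMMSE.HasContinuousIntegrableDerivs (p i j))
    -- the integer `d` is defined
    (hd : ∃ n : ℕ, FadingMMSE.pairSum p n ≠ 0) :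
    (∀ snr : ℝ, 0 < snr →
      Integrable (fun ω => FadingMMSE.mmse P x noise snr (H ω)) P) ∧
    ∃ ε : ℝ → ℝ,
      FadingMMSE.PiecewiseSmoothOn ε (Ioi 0) ∧
      ((fun snr : ℝ => FadingMMSE.avgMmse P H x noise snr
          - ε snr * (1 / snr ^ (FadingMMSE.order p + 1)))
        =O[atTop] (fun snr : ℝ => 1 / snr ^ (FadingMMSE.order p + 2))) ∧
      (∃ snr₀ : ℝ, 0 < snr₀ ∧ ∀ snr : ℝ, snr₀ ≤ snr →
        FadingMMSE.kLB M (FadingMMSE.order p) *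
            FadingMMSE.pairSum p (FadingMMSE.order p - 1) ≤ ε snr ∧
        ε snr ≤ FadingMMSE.kUB M (FadingMMSE.order p) *
            FadingMMSE.pairSum p (FadingMMSE.order p - 1)) ∧
      limsup ε atTop =
        limsup (fun snr : ℝ =>
          snr ^ (FadingMMSE.order p + 1) * FadingMMSE.avgMmse P H x noise snr) atTop ∧
      liminf ε atTop =
        liminf (fun snr : ℝ =>
          snr ^ (FadingMMSE.order p + 1) * FadingMMSE.avgMmse P H x noise snr) atTop := by
  have hM2 : (2 : ℝ) ≤ M := by exact_mod_cast FadingMMSE.two_le_of_pairSum_ne_zero hd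
  have : NeZero M := ⟨by rintro rfl; norm_num at hM2⟩
  have h : FadingMMSE.UniformGaussian P x noise c := ⟨hx, hnoise, hc, hunif, hgauss, hindep⟩
  refine ⟨fun snr hs => h.integrable_mmse hH hs, ?_⟩
  obtain ⟨C, hC⟩ := FadingMMSE.exists_integral_pairTail_bound hH hp hsmooth
  set d := FadingMMSE.order p with hd_def
  set A : ℝ := FadingMMSE.kCommon d * FadingMMSE.pairSum p (d - 1) with hA
  have hM1 : (0 : ℝ) < M - 1 := by linarith
  have hM0 : (0 : ℝ) < M := by linarith
  have hLB : FadingMMSE.kLB M d * FadingMMSE.pairSum p (d - 1) = A / (2 * M * (M - 1)) := by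
    rw [FadingMMSE.kLB, hA, FadingMMSE.kCommon]; ring
  have hUB : FadingMMSE.kUB M d * FadingMMSE.pairSum p (d - 1) = 2 * A / M := by
    rw [FadingMMSE.kUB, hA, FadingMMSE.kCommon]; ring
  -- the upper bound on `mmse` is this quantity over `M`, the lower one is it over `4M(M-1)`
  have hT : ∀ s : ℝ, 0 < s →
      |s ^ (d + 1) * (∫ ω, FadingMMSE.pairTail c (H ω) s ∂P) - 2 * A| ≤ |C| / s := by
    intro s hs
    have h1 := mul_le_mul_of_nonneg_left ((hC s hs).trans
      (div_le_div_of_nonneg_right (le_abs_self C) (by positivity))) (pow_pos hs (d + 1)).le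
    rw [← abs_of_pos (pow_pos hs (d + 1)), ← abs_mul, abs_of_pos (pow_pos hs (d + 1)), mul_sub,
      mul_assoc 2, ← hA, mul_div_cancel₀ _ (pow_pos hs (d + 1)).ne'] at h1
    refine h1.trans (le_of_eq ?_)
    rw [pow_succ s (d + 1)]
    field_simp
  -- `A` is half the limit of a nonnegative quantity
  have hA0 : 0 ≤ A := by
    have hlim : Tendsto (fun s : ℝ => -(|C| / s) / 2) atTop (nhds (-0 / 2)) :=
      ((tendsto_const_nhds.div_atTop tendsto_id).neg).div_const 2
    rw [neg_zero, zero_div] at hlim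
    refine le_of_tendsto hlim ?_
    filter_upwards [eventually_gt_atTop 0] with s hs
    have h1 := (abs_le.1 (hT s hs)).2
    have h2 : 0 ≤ s ^ (d + 1) * ∫ ω, FadingMMSE.pairTail c (H ω) s ∂P :=
      mul_nonneg (pow_pos hs _).le (integral_nonneg fun ω => FadingMMSE.pairTail_nonneg _ _)
    linarith
  have hLU : A / (2 * M * (M - 1)) ≤ 2 * A / M := by
    rw [div_le_div_iff₀ (by positivity) hM0]
    nlinarith [mul_nonneg hA0 hM0.le, mul_nonneg (mul_nonneg hA0 hM0.le) hM1.le]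
  obtain ⟨ε, hε, hbd, hclose, hsup, hinf⟩ := FadingMMSE.exists_smooth_coefficient
    (f := fun s => s ^ (d + 1) * FadingMMSE.avgMmse P H x noise s) (C := |C|)
    ((continuousOn_pow _).mul (h.continuousOn_avgMmse hH)) hLU (abs_nonneg C)
    (fun s hs => by
      have h1 := mul_le_mul_of_nonneg_left (h.avgMmse_bounds hH hs).1 (pow_pos hs (d + 1)).le
      have h2 := (abs_le.1 (hT s hs)).1
      have h3 : (1 : ℝ) ≤ 4 * M * (M - 1) := by nlinarith
      have h4 : 0 ≤ |C| / s := by positivity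
      have h5 : A / (2 * M * (M - 1)) * (4 * M * (M - 1)) = 2 * A := by field_simp; norm_num
      refine le_of_mul_le_mul_right ?_ (zero_lt_one.trans_le h3)
      have h6 := mul_le_mul_of_nonneg_left h3 h4
      rw [sub_mul, h5]
      linarith)
    (fun s hs => by
      have h1 := mul_le_mul_of_nonneg_left (h.avgMmse_bounds hH hs).2 (pow_pos hs (d + 1)).le
      have h2 := (abs_le.1 (hT s hs)).2
      have h4 : 0 ≤ |C| / s := by positivity
      have h5 : 2 * A / M * M = 2 * A := by field_simp
      have h6 : s ^ (d + 1) * (1 / (M : ℝ) * ∫ ω, FadingMMSE.pairTail c (H ω) s ∂P) * M =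
          s ^ (d + 1) * ∫ ω, FadingMMSE.pairTail c (H ω) s ∂P := by field_simp
      refine le_of_mul_le_mul_right ?_ hM0
      have h7 := mul_le_mul_of_nonneg_right h1 hM0.le
      have h8 : |C| / s * 1 ≤ |C| / s * M := by gcongr; linarith
      rw [h6] at h7
      rw [add_mul, h5]
      linarith)
  refine ⟨ε, ⟨∅, by simp, fun a b _ _ _ => hε.contDiffOn⟩, ?_, ⟨1, one_pos, fun s hs => ?_⟩,
    hsup, hinf⟩
  · refine IsBigO.of_bound (|C| + 1) ?_
    filter_upwards [eventually_ge_atTop 1] with s hs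
    have hs0 : 0 < s := zero_lt_one.trans_le hs
    have hfac : FadingMMSE.avgMmse P H x noise s - ε s * (1 / s ^ (d + 1)) =
        (s ^ (d + 1) * FadingMMSE.avgMmse P H x noise s - ε s) * (1 / s ^ (d + 1)) := by
      field_simp
    rw [hfac, norm_mul, Real.norm_of_nonneg (by positivity : 0 ≤ 1 / s ^ (d + 1)),
      Real.norm_of_nonneg (by positivity : 0 ≤ 1 / s ^ (d + 2)), Real.norm_eq_abs]
    refine (mul_le_mul_of_nonneg_right (hclose s hs) (by positivity)).trans (le_of_eq ?_)
    rw [pow_succ s (d + 1)]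
    field_simp
  · rw [hLB, hUB]
    exact hbd s hs
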